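/- Let $N=\{0,1\}^n$, $D=\{0,1\}^d$, $M'=\{0,1\}^{m'}$, let $\mathrm{Ext}=\{f_s\}_{s\in D}$ be a family of functions $f_s:N\to M'$, let $k\in\mathbb R$ and $\varepsilon>0$; $\log$ is to base $2$. For a set $X$ we also write $X$ for its cardinality, and $\upsilon_X$ for the uniform distribution on $X$. Let $F_s$ be the linear map with $F_s(P)(y)=\sum_{x:f_s(x)=y}P(x)$, and let $$\Delta[\mathrm{Ext}]_S(P)=\frac1D\sum_{s\in D}F_s(P)\otimes|s\rangle\langle s|-\Big(\sum_xP(x)\Big)\,\upsilon_{M'}\otimes\upsilon_D .$$ *Norms.* For a vector $P$ on $N$ put $\|P\|_{\cap\{K\ell_\infty,\ell_1\}}=\max\{K\|P\|_{\ell_\infty},\|P\|_{\ell_1}\}$. The bounded norm of a linear map $u$ is $\sup\{\|u(P)\|:\|P\|\le1\}$ (scalars real or complex, the statement holds for either). For $Q\in\mathbb N$ view $x\in\mathrm{Mat}_Q(\mathbb C^N)$ as a block-diagonal matrix in $\mathrm{Mat}_Q\otimes\mathrm{Mat}_N$. Write $\|\cdot\|_\infty,\|\cdot\|_1,\|\cdot\|_2$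 for the operator, trace and Hilbert--Schmidt norms, let $\Gamma$ be the linear map with $\Gamma(|i\rangle\langle j|\otimes|k\rangle\langle l|)=|i\rangle\langle j|\otimes\langle k|\otimes\langle l|$, and put $|a|_K=\max\{\sqrt K\|a\|_\infty,\|\Gamma(a)\|_\infty\}$. The operator space $\cap\cdot\cap\{K\ell_\infty,\ell_1\}$ on $\mathbb C^N$ has the norms $$\|x\|_{M_Q(\cap\cdot\cap)}=\inf\{|a|_K\,|b|_K:\ x=ab^*,\ a,b\in\mathrm{Mat}_Q\otimes\mathrm{Mat}_N\},$$ and the operator space $\ell_1$ on $\mathbb C^{X}$ has the norms $$\|x\|_{M_Q(\ell_1)}=\sup\{\|(A\otimes1)x(B\otimes1)\|_1:\ A,B\in\mathrm{Mat}_Q,\ \|A\|_2,\|B\|_2\le1\}.$$ The completely bounded norm is $\|u:E\to F\|_{\mathrm{cb}}=\sup_{Q\in\mathbb N}\sup\{\|(\mathrm{id}_Q\otimes u)(x)\|_{M_Q(F)}:\ \|x\|_{M_Q(E)}\le1\}$. *Extractors.* $\mathrm{Ext}$ is a strong $(k,\varepsilon)$-extractor if $\frac1D\sum_s\|F_s(P)-\upsilon_{M'}\|_{\ell_1}\le\varepsilon$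 for every probability distribution $P$ on $N$ with $-\log\|P\|_{\ell_\infty}\ge k$. It is a quantum-proof strong $(k,\varepsilon)$-extractor if for every finite-dimensional $Q$ and every classical-quantum density matrix $\rho_{QN}=\sum_x\rho_x\otimes|x\rangle\langle x|$ with $H_{\min}(N|Q)_\rho\ge k$ one has $\frac1D\sum_s\|(\mathrm{id}\otimes F_s)(\rho_{QN})-\rho_Q\otimes\upsilon_{M'}\|_1\le\varepsilon$; here $H_{\min}(N|Q)_\rho=-\log\min_\sigma\|(\sigma^{-1/2}\otimes1)\rho_{QN}(\sigma^{-1/2}\otimes1)\|_\infty$, with generalized inverses and the minimum over density matrices $\sigma$ on $Q$ whose support contains that of $\rho_Q$. **Theorem.** (a) If $$\big\|\Delta[\mathrm{Ext}]_S:\cap\{2^k\ell_\infty,\ell_1\}\to\ell_1\big\|\le\varepsilon,$$ then $$\big\|\Delta[\mathrm{Ext}]_S:\cap\cdot\cap\{2^{k+\log(1/\varepsilon)}\ell_\infty,\ell_1\}\to\ell_1\big\|_{\mathrm{cb}}\le4\sqrt{2^{m'}}\sqrt{2\varepsilon}.$$ (b) If $\mathrm{Ext}$ is a strong $(k,\varepsilon)$-extractor,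 then it is a quantum-proof strong $\big(k+\log(2/\varepsilon),\,12\sqrt{2^{m'}}\sqrt{2\varepsilon}\big)$-extractor. -/

import Mathlib

open scoped ENNReal Matrix Kronecker ComplexOrder

noncomputable section

namespace QExt

/-! ## Matrix norms -/

section MatrixNorms

variable {ι κ : Type*} [Fintype ι] [DecidableEq ι] [Fintype κ] [DecidableEq κ]

open scoped Matrix.Norms.L2Operator in
/-- The operator norm (largest singular value) of a complex, possibly rectangular, matrix. -/
def opNorm (A : Matrix ι κ ℂ) : ℝ := ‖A‖

/-- The trace norm `Tr √(A* A)`. -/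
def traceNorm (A : Matrix ι ι ℂ) : ℝ := (cfc Real.sqrt (Aᴴ * A)).trace.re

/-- The Hilbert-Schmidt norm `√(Tr (A* A))`. -/
def hsNorm (A : Matrix ι ι ℂ) : ℝ := Real.sqrt (Aᴴ * A).trace.re

/-- `σ ^ (-1/2)` for a positive semidefinite `σ`, with the generalized inverse
(eigenvalue `0` is sent to `0`). -/
def invSqrt (σ : Matrix ι ι ℂ) : Matrix ι ι ℂ := cfc (fun t : ℝ => (Real.sqrt t)⁻¹) σ

end MatrixNorms

/-! ## Bounded and completely bounded norms of linear maps

Norms are given as functions with values in `[0, ∞]`, so that suprema and infima are genuine. -/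

/-- The bounded norm `sup {‖u x‖_W : ‖x‖_V ≤ 1}`. -/
def boundedNorm {𝕜 V W : Type*} [RCLike 𝕜] [AddCommGroup V] [Module 𝕜 V] [AddCommGroup W]
    [Module 𝕜 W] (nV : V → ℝ≥0∞) (nW : W → ℝ≥0∞) (u : V →ₗ[𝕜] W) : ℝ≥0∞ :=
  ⨆ (x : V) (_ : nV x ≤ 1), nW (u x)

/-- The completely bounded norm: the supremum over `Q` of the bounded norms of
`u_Q : Mat_Q(V) → Mat_Q(W)`, where `u_Q` applies `u` to every entry. The arguments `nV Q` and
`nW Q` are the norms on `Mat_Q(V)` and on `Mat_Q(W)`. -/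
def cbNorm {V W : Type*} [AddCommGroup V] [Module ℂ V] [AddCommGroup W] [Module ℂ W]
    (nV : ∀ Q : ℕ, Matrix (Fin Q) (Fin Q) V → ℝ≥0∞)
    (nW : ∀ Q : ℕ, Matrix (Fin Q) (Fin Q) W → ℝ≥0∞) (u : V →ₗ[ℂ] W) : ℝ≥0∞ :=
  ⨆ (Q : ℕ) (x : Matrix (Fin Q) (Fin Q) V) (_ : nV Q x ≤ 1), nW Q (x.map u)

section VectorNorms

variable {𝕜 N : Type*} [RCLike 𝕜] [Fintype N]

/-- The `ℓ₁` norm of a vector. -/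
def l1Norm (P : N → 𝕜) : ℝ := ∑ x, ‖P x‖

/-- The `ℓ_∞` norm of a vector (Mathlib's norm on functions on a finite type). -/
def linftyNorm (P : N → 𝕜) : ℝ := ‖P‖

/-- The norm of `∩{K ℓ_∞, ℓ₁}`. -/
def capNorm (K : ℝ) (P : N → 𝕜) : ℝ := max (K * linftyNorm P) (l1Norm P)

end VectorNorms

/-! ## Operator space structures on `ℂ^N`

An element of `Mat_Q(N)` is a `Q × Q` matrix with entries in `ℂ^N`; it is embedded into the
`QN × QN` matrices as the block-diagonal matrix `∑ x, ρ(x) ⊗ |x⟩⟨x|`. -/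

section OperatorSpaces

variable {N : Type*} [Fintype N] [DecidableEq N]

/-- The embedding of `Mat_Q(N)` into `Mat_{QN}` as block-diagonal matrices. -/
def blockEmbed {Q : ℕ} (z : Matrix (Fin Q) (Fin Q) (N → ℂ)) :
    Matrix (Fin Q × N) (Fin Q × N) ℂ :=
  Matrix.of fun p q => if p.2 = q.2 then z p.1 q.1 p.2 else 0

/-- `Γ(|i⟩⟨j| ⊗ |k⟩⟨l|) = |i⟩⟨j| ⊗ ⟨k| ⊗ ⟨l|`, extended linearly. -/
def Gam {Q : ℕ} (a : Matrix (Fin Q × N) (Fin Q × N) ℂ) : Matrix (Fin Q) (Fin Q × N × N) ℂ :=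
  Matrix.of fun i p => a (i, p.2.1) (p.1, p.2.2)

/-- `max {√K ‖a‖_{(∞;∞)}, ‖Γ(a)‖_∞}`, the size of one factor in the `∩·∩` norm. -/
def factorNorm {Q : ℕ} (K : ℝ) (a : Matrix (Fin Q × N) (Fin Q × N) ℂ) : ℝ :=
  max (Real.sqrt K * opNorm a) (opNorm (Gam a))

/-- The norm on `Mat_{QN}` of the operator space `∩·∩{K M_N, S¹_N}`: an infimum over
factorizations `x = a b*`. -/
def capcapMat {Q : ℕ} (K : ℝ) (x : Matrix (Fin Q × N) (Fin Q × N) ℂ) : ℝ≥0∞ :=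
  ⨅ (a : Matrix (Fin Q × N) (Fin Q × N) ℂ) (b : Matrix (Fin Q × N) (Fin Q × N) ℂ)
    (_ : x = a * bᴴ), ENNReal.ofReal (factorNorm K a * factorNorm K b)

/-- The norms of the operator space `∩·∩{K ℓ_∞, ℓ₁}` on `ℂ^N`. -/
def capcapNorm (K : ℝ) (Q : ℕ) (z : Matrix (Fin Q) (Fin Q) (N → ℂ)) : ℝ≥0∞ :=
  capcapMat K (blockEmbed z)

/-- The `(∞;1)` norm on `Mat_{QN}`, which is the norm on `Mat_Q` of the trace class operator
space `S¹_N`: the supremum of the trace norms of `(A ⊗ 1) x (B ⊗ 1)` over `A`, `B` in the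
Hilbert-Schmidt unit ball. -/
def infOneMat {Q : ℕ} (x : Matrix (Fin Q × N) (Fin Q × N) ℂ) : ℝ≥0∞ :=
  ⨆ (A : Matrix (Fin Q) (Fin Q) ℂ) (B : Matrix (Fin Q) (Fin Q) ℂ)
    (_ : hsNorm A ≤ 1) (_ : hsNorm B ≤ 1),
    ENNReal.ofReal
      (traceNorm ((A ⊗ₖ (1 : Matrix N N ℂ)) * x * (B ⊗ₖ (1 : Matrix N N ℂ))))

/-- The norms of the operator space `ℓ₁` on `ℂ^N`. -/
def l1OpNorm (Q : ℕ) (z : Matrix (Fin Q) (Fin Q) (N → ℂ)) : ℝ≥0∞ :=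
  infOneMat (blockEmbed z)

end OperatorSpaces

/-! ## Extractors -/

section Extractors

variable {N D M : Type*} [Fintype N] [DecidableEq N] [Fintype D] [DecidableEq D]
  [Fintype M] [DecidableEq M]

/-- The linear map `F_s` of a function `g = f_s : N → M`, given by the `M × N` matrix whose
`(y, x)` entry is `1` if `g x = y` and `0` otherwise. -/
def push (𝕜 : Type*) [RCLike 𝕜] (g : N → M) : (N → 𝕜) →ₗ[𝕜] (M → 𝕜) :=
  Matrix.mulVecLin (Matrix.of fun y x => if g x = y then 1 else 0)

/-- `Δ[Ext]_S (P) = (1/D) ∑ s, F_s(P) ⊗ |s⟩⟨s| - (1ᵀ P) υ_M ⊗ υ_D`, where `υ` is uniform;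
the `(y, s)` coordinate of `∑ s, F_s(P) ⊗ |s⟩⟨s|` is `F_s(P)(y)`. -/
def deltaS (𝕜 : Type*) [RCLike 𝕜] (f : D → N → M) : (N → 𝕜) →ₗ[𝕜] (M × D → 𝕜) where
  toFun P := fun p => (Fintype.card D : 𝕜)⁻¹ * push 𝕜 (f p.2) P p.1
    - (∑ x, P x) * ((Fintype.card M : 𝕜)⁻¹ * (Fintype.card D : 𝕜)⁻¹)
  map_add' P R := by
    ext p
    simp only [map_add, Pi.add_apply, Finset.sum_add_distrib]
    ring
  map_smul' c P := by
    ext p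
    simp only [map_smul, Pi.smul_apply, smul_eq_mul, ← Finset.mul_sum, RingHom.id_apply]
    ring

/-- The min-entropy (in bits) of a probability distribution. -/
def minEntropy (P : N → ℝ) : ℝ := -Real.logb 2 (linftyNorm P)

/-- `f` is a strong `(k, ε)`-extractor: for every probability distribution `P` on `N` of
min-entropy at least `k`, `(1/D) ∑ s, ‖F_s(P) - υ_M‖₁ ≤ ε`. -/
def IsStrongExtractor (f : D → N → M) (k ε : ℝ) : Prop :=
  ∀ P : N → ℝ, (∀ x, 0 ≤ P x) → ∑ x, P x = 1 → k ≤ minEntropy P →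
    (Fintype.card D : ℝ)⁻¹ *
      ∑ s, l1Norm (push ℝ (f s) P - fun _ => (Fintype.card M : ℝ)⁻¹) ≤ ε

/-- The marginal on `Q` of an element of `Mat_Q(N)`. -/
def marginal {Q : ℕ} (ρ : Matrix (Fin Q) (Fin Q) (N → ℂ)) : Matrix (Fin Q) (Fin Q) ℂ :=
  ρ.map fun v => ∑ x, v x

/-- Classical-quantum density matrices. -/
def IsCQState {Q : ℕ} (ρ : Matrix (Fin Q) (Fin Q) (N → ℂ)) : Prop :=
  (blockEmbed ρ).PosSemidef ∧ (blockEmbed ρ).trace = 1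

/-- The conditional min-entropy
`-log min_σ ‖(σ^(-1/2) ⊗ 1) ρ (σ^(-1/2) ⊗ 1)‖_{(∞;∞)}` (in bits). The minimum is over the states
`σ` on `Q` whose support contains that of `ρ_Q`, as always when generalized inverses are used. -/
def condMinEntropy {Q : ℕ} (ρ : Matrix (Fin Q) (Fin Q) (N → ℂ)) : ℝ :=
  -Real.logb 2 (sInf {r : ℝ | ∃ σ : Matrix (Fin Q) (Fin Q) ℂ, σ.PosSemidef ∧ σ.trace = 1 ∧
    (∀ v, σ *ᵥ v = 0 → marginal ρ *ᵥ v = 0) ∧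
    r = opNorm ((invSqrt σ ⊗ₖ (1 : Matrix N N ℂ)) * blockEmbed ρ *
      (invSqrt σ ⊗ₖ (1 : Matrix N N ℂ)))})

/-- `ρ_Q ⊗ υ_M` as an element of `Mat_Q(M)`. -/
def tensorUniform {Q : ℕ} (M : Type*) [Fintype M] (ρQ : Matrix (Fin Q) (Fin Q) ℂ) :
    Matrix (Fin Q) (Fin Q) (M → ℂ) :=
  ρQ.map fun c _ => c * (Fintype.card M : ℂ)⁻¹

/-- `f` is a quantum-proof strong `(k, ε)`-extractor: for every finite-dimensional `Q` and every
classical-quantum state `ρ_{QN}` with conditional min-entropy at least `k`,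
`(1/D) ∑ s, ‖(id ⊗ F_s)(ρ_{QN}) - ρ_Q ⊗ υ_M‖₁ ≤ ε`. -/
def IsQuantumProofStrongExtractor (f : D → N → M) (k ε : ℝ) : Prop :=
  ∀ (Q : ℕ) (ρ : Matrix (Fin Q) (Fin Q) (N → ℂ)), IsCQState ρ → k ≤ condMinEntropy ρ →
    (Fintype.card D : ℝ)⁻¹ *
      ∑ s, traceNorm (blockEmbed (ρ.map (push ℂ (f s)) - tensorUniform M (marginal ρ))) ≤ ε

end Extractors

end QExt

end

/-!
Write `δ` for the real matrix of `Δ = deltaS`. By the polar decompositions of `A`, `B` and a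
Cauchy–Schwarz inequality for the trace,
`‖A Y B‖₁² ≤ ‖A‖₂ ‖B‖₂ tr (|A| Y |B*| Y*)`. For `Y i = ∑ x, δ i x • a x (b x)*` the trace on the
right is a quadratic form in the row `δ i`, so after summation over `i` it is controlled by
`∑ x', ‖Δ (q x')‖₁` for the scalar vectors `q x' x = tr (|A| a x (b x)* |B*| b x' (a x')*)`. A
second Cauchy–Schwarz inequality bounds the sum of the `∩{K ℓ_∞, ℓ₁}` norms of the `q x'`. Hence
a bound for `Δ` on real vectors gives a completely bounded one. The factor `√|M|` is the price of
passing from `∑ i, ‖A Y i B‖₁` to the sum of squares, reduced by the entries of `δ` being at most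
`1 / |D|`.

For a state `ρ` of large conditional min-entropy, `ρ x ≤ t σ` for a density matrix `σ` on `Q`. With
`τ = σ + ρ_Q`, the matrices `τ^(-1/2) (ρ x) τ^(-1/2)` lie in the unit ball of the operator version
of `∩{K ℓ_∞, ℓ₁}`, and the same estimate applies with `A = B = τ^(1/2)`.
-/

namespace QExt

open scoped MatrixOrder Matrix.Norms.L2Operator

section LoewnerOrder

lemma mul_conjTranspose_nonneg {ι κ : Type*} [Finite ι] [Fintype κ] (A : Matrix ι κ ℂ) :
    0 ≤ A * Aᴴ :=
  (Matrix.posSemidef_self_mul_conjTranspose A).nonneg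

variable {ι κ : Type*} [Fintype ι]

lemma re_trace_nonneg {P : Matrix ι ι ℂ} (hP : 0 ≤ P) : 0 ≤ P.trace.re :=
  (Complex.le_def.1 (Matrix.nonneg_iff_posSemidef.1 hP).trace_nonneg).1

lemma conj_nonneg [Finite κ] {P : Matrix ι ι ℂ} (hP : 0 ≤ P) (A : Matrix κ ι ℂ) :
    0 ≤ A * P * Aᴴ :=
  ((Matrix.nonneg_iff_posSemidef.1 hP).mul_mul_conjTranspose_same A).nonneg

lemma conj_le_conj [Finite κ] {P R : Matrix ι ι ℂ} (h : P ≤ R) (A : Matrix κ ι ℂ) :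
    A * P * Aᴴ ≤ A * R * Aᴴ := by
  rw [← sub_nonneg, ← Matrix.sub_mul, ← Matrix.mul_sub]
  exact conj_nonneg (sub_nonneg.2 h) A

lemma re_trace_mono {P R : Matrix ι ι ℂ} (h : P ≤ R) : P.trace.re ≤ R.trace.re := by
  simpa using re_trace_nonneg (sub_nonneg.2 h)

lemma re_trace_mul_le_mul_right {P R S : Matrix ι ι ℂ} (h : P ≤ R) (hS : 0 ≤ S) :
    (P * S).trace.re ≤ (R * S).trace.re := by
  classical
  obtain ⟨B, rfl⟩ := CStarAlgebra.nonneg_iff_eq_star_mul_self.1 hS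
  have trace_cyc (X : Matrix ι ι ℂ) : (X * (star B * B)).trace = (B * X * Bᴴ).trace := by
    rw [← Matrix.mul_assoc, Matrix.trace_mul_comm, ← Matrix.mul_assoc, Matrix.star_eq_conjTranspose]
  rw [trace_cyc, trace_cyc]
  exact re_trace_mono (conj_le_conj h B)

lemma re_trace_mul_nonneg {P R : Matrix ι ι ℂ} (hP : 0 ≤ P) (hR : 0 ≤ R) :
    0 ≤ (P * R).trace.re := by
  simpa using re_trace_mul_le_mul_right hP hR

variable [Fintype κ]

lemma re_trace_mul_conjTranspose (X : Matrix ι κ ℂ) :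
    (X * Xᴴ).trace.re = ∑ p : ι × κ, ‖X p.1 p.2‖ ^ 2 := by
  simp only [Matrix.trace, Matrix.diag_apply, Matrix.mul_apply, Matrix.conjTranspose_apply,
    Complex.star_def, Complex.mul_conj, Complex.normSq_eq_norm_sq, Complex.re_sum,
    Complex.ofReal_re, Fintype.sum_prod_type]

lemma re_trace_mul_sq_le (X : Matrix ι κ ℂ) (Y : Matrix κ ι ℂ) :
    (X * Y).trace.re ^ 2 ≤ (X * Xᴴ).trace.re * (Y * Yᴴ).trace.re := by
  have hXY : (X * Y).trace = ∑ p : ι × κ, X p.1 p.2 * Y p.2 p.1 := by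
    simp only [Matrix.trace, Matrix.diag_apply, Matrix.mul_apply, Fintype.sum_prod_type]
  have hY : (Y * Yᴴ).trace.re = ∑ p : ι × κ, ‖Y p.2 p.1‖ ^ 2 := by
    rw [re_trace_mul_conjTranspose, ← (Equiv.prodComm ι κ).sum_comp]
    rfl
  have habs : |(X * Y).trace.re| ≤ ∑ p : ι × κ, ‖X p.1 p.2‖ * ‖Y p.2 p.1‖ := by
    rw [hXY]
    exact (Complex.abs_re_le_norm _).trans (norm_sum_le_of_le _ fun p _ => (norm_mul _ _).le)
  rw [re_trace_mul_conjTranspose, hY, ← sq_abs]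
  exact (pow_le_pow_left₀ (abs_nonneg _) habs 2).trans (Finset.sum_mul_sq_le_sq_mul_sq _ _ _)

lemma hsNorm_nonneg (A : Matrix ι ι ℂ) : 0 ≤ hsNorm A := Real.sqrt_nonneg _

lemma hsNorm_sq (A : Matrix ι ι ℂ) : hsNorm A ^ 2 = (Aᴴ * A).trace.re :=
  Real.sq_sqrt (re_trace_nonneg (Matrix.posSemidef_conjTranspose_mul_self A).nonneg)

lemma hsNorm_conjTranspose (A : Matrix ι ι ℂ) : hsNorm Aᴴ = hsNorm A := by
  rw [hsNorm, hsNorm, Matrix.conjTranspose_conjTranspose, Matrix.trace_mul_comm]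

lemma re_trace_mul_le_hsNorm_mul_hsNorm (X Y : Matrix ι ι ℂ) :
    (X * Y).trace.re ≤ hsNorm X * hsNorm Y := by
  refine (abs_le_of_sq_le_sq' ?_ (mul_nonneg (hsNorm_nonneg X) (hsNorm_nonneg Y))).2
  rw [mul_pow, ← hsNorm_conjTranspose X, ← hsNorm_conjTranspose Y, hsNorm_sq, hsNorm_sq,
    Matrix.conjTranspose_conjTranspose, Matrix.conjTranspose_conjTranspose]
  exact re_trace_mul_sq_le X Y

variable [DecidableEq ι] [DecidableEq κ]

lemma opNorm_sq_le_iff {A : Matrix ι κ ℂ} {r : ℝ} (hr : 0 ≤ r) :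
    opNorm A ^ 2 ≤ r ↔ A * Aᴴ ≤ r • 1 := by
  rw [← Algebra.algebraMap_eq_smul_one,
    ← CStarAlgebra.norm_le_iff_le_algebraMap _ hr (mul_conjTranspose_nonneg A)]
  have := Matrix.l2_opNorm_conjTranspose_mul_self Aᴴ
  rw [Matrix.conjTranspose_conjTranspose, Matrix.l2_opNorm_conjTranspose] at this
  rw [this, ← sq, opNorm]

lemma opNorm_conjTranspose (A : Matrix ι κ ℂ) : opNorm Aᴴ = opNorm A :=
  Matrix.l2_opNorm_conjTranspose A

lemma opNorm_mul_le_one {A B : Matrix ι ι ℂ} (hA : opNorm A ≤ 1) (hB : opNorm B ≤ 1) :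
    opNorm (A * B) ≤ 1 :=
  (Matrix.l2_opNorm_mul A B).trans (mul_le_one₀ hA (norm_nonneg B) hB)

lemma opNorm_le_one_iff {A : Matrix ι κ ℂ} : opNorm A ≤ 1 ↔ A * Aᴴ ≤ 1 := by
  simpa [sq_le_one_iff₀ (norm_nonneg A), opNorm] using opNorm_sq_le_iff (A := A) zero_le_one

lemma hsNorm_mul_le {W A : Matrix ι ι ℂ} (hW : opNorm W ≤ 1) : hsNorm (W * A) ≤ hsNorm A := by
  rw [← opNorm_conjTranspose, opNorm_le_one_iff, Matrix.conjTranspose_conjTranspose] at hW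
  refine Real.sqrt_le_sqrt (re_trace_mono ?_)
  simpa [Matrix.mul_assoc] using conj_le_conj hW Aᴴ

lemma hsNorm_conj_le {W : Matrix ι ι ℂ} (hW : opNorm W ≤ 1) (A : Matrix ι ι ℂ) :
    hsNorm (W * A * Wᴴ) ≤ hsNorm A :=
  calc hsNorm (W * A * Wᴴ) = hsNorm (W * (W * A)ᴴ) := by
        rw [← hsNorm_conjTranspose, Matrix.conjTranspose_mul, Matrix.conjTranspose_conjTranspose]
    _ ≤ hsNorm (W * A)ᴴ := hsNorm_mul_le hW
    _ = hsNorm (W * A) := hsNorm_conjTranspose _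
    _ ≤ hsNorm A := hsNorm_mul_le hW

end LoewnerOrder

section SquareRoots

variable {ι : Type*} [Fintype ι] [DecidableEq ι]

lemma cfc_real_sqrt {σ : Matrix ι ι ℂ} (hσ : 0 ≤ σ) : cfc Real.sqrt σ = CFC.sqrt σ := by
  rw [CFC.sqrt_eq_real_sqrt σ hσ, cfcₙ_eq_cfc]

lemma traceNorm_eq_re_trace_abs (X : Matrix ι ι ℂ) : traceNorm X = (CFC.abs X).trace.re := by
  rw [traceNorm, ← Matrix.star_eq_conjTranspose, cfc_real_sqrt (star_mul_self_nonneg X), CFC.abs]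

lemma traceNorm_smul {t : ℝ} (ht : 0 ≤ t) (X : Matrix ι ι ℂ) :
    traceNorm (t • X) = t * traceNorm X := by
  rw [traceNorm_eq_re_trace_abs, traceNorm_eq_re_trace_abs, CFC.abs_smul, Real.norm_of_nonneg ht,
    Matrix.trace_smul, Complex.smul_re, smul_eq_mul]

lemma conjTranspose_sqrt (σ : Matrix ι ι ℂ) : (CFC.sqrt σ)ᴴ = CFC.sqrt σ :=
  (CFC.sqrt_nonneg σ).isSelfAdjoint

lemma conjTranspose_abs (σ : Matrix ι ι ℂ) : (CFC.abs σ)ᴴ = CFC.abs σ :=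
  (CFC.abs_nonneg σ).isSelfAdjoint

lemma conjTranspose_invSqrt (σ : Matrix ι ι ℂ) : (invSqrt σ)ᴴ = invSqrt σ :=
  cfc_predicate (R := ℝ) (p := IsSelfAdjoint) _ σ

lemma continuousOn_spectrum (f : ℝ → ℝ) (σ : Matrix ι ι ℂ) : ContinuousOn f (spectrum ℝ σ) :=
  Matrix.finite_real_spectrum.continuousOn f

lemma invSqrt_mul_self {σ : Matrix ι ι ℂ} (hσ : 0 ≤ σ) : invSqrt σ * σ = CFC.sqrt σ := by
  have hsa : IsSelfAdjoint σ := .of_nonneg hσ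
  nth_rw 2 [← cfc_id' ℝ σ]
  rw [invSqrt, ← cfc_mul _ _ σ (continuousOn_spectrum _ σ) (continuousOn_spectrum _ σ),
    ← cfc_real_sqrt hσ]
  refine cfc_congr fun t _ => ?_
  rw [inv_mul_eq_div, Real.div_sqrt]

lemma invSqrt_mul_sqrt_comm {σ : Matrix ι ι ℂ} (hσ : 0 ≤ σ) :
    invSqrt σ * CFC.sqrt σ = CFC.sqrt σ * invSqrt σ := by
  rw [← cfc_real_sqrt hσ]
  exact cfc_commute_cfc _ _ σ

lemma invSqrt_mul_self_mul_invSqrt_le_one {σ : Matrix ι ι ℂ} (hσ : 0 ≤ σ) :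
    invSqrt σ * σ * invSqrt σ ≤ 1 := by
  rw [invSqrt_mul_self hσ, invSqrt, ← cfc_real_sqrt hσ,
    ← cfc_mul _ _ σ (continuousOn_spectrum _ σ) (continuousOn_spectrum _ σ)]
  exact cfc_le_one _ σ fun t _ => mul_inv_le_one

lemma self_mul_invSqrt_mul_sqrt {σ : Matrix ι ι ℂ} (hσ : 0 ≤ σ) :
    σ * (invSqrt σ * CFC.sqrt σ) = σ := by
  have hS : CFC.sqrt σ * CFC.sqrt σ = σ := CFC.sqrt_mul_sqrt_self σ hσ
  calc σ * (invSqrt σ * CFC.sqrt σ)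
      = CFC.sqrt σ * (CFC.sqrt σ * invSqrt σ) * CFC.sqrt σ := by
        nth_rw 1 [← hS]
        simp only [mul_assoc]
    _ = CFC.sqrt σ * (invSqrt σ * (CFC.sqrt σ * CFC.sqrt σ)) := by
        rw [← invSqrt_mul_sqrt_comm hσ]
        simp only [mul_assoc]
    _ = σ := by rw [hS, invSqrt_mul_self hσ, hS]

lemma mul_invSqrt_mul_sqrt_of_ker_le {κ : Type*} {σ : Matrix ι ι ℂ} (hσ : 0 ≤ σ)
    {P : Matrix κ ι ℂ} (hker : ∀ v, σ *ᵥ v = 0 → P *ᵥ v = 0) :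
    P * (invSqrt σ * CFC.sqrt σ) = P := by
  have hσE : σ * (1 - invSqrt σ * CFC.sqrt σ) = 0 := by
    rw [mul_sub, mul_one, self_mul_invSqrt_mul_sqrt hσ, sub_self]
  have hPE : P * (1 - invSqrt σ * CFC.sqrt σ) = 0 := by
    refine Matrix.ext_of_mulVec_single fun i => ?_
    rw [← Matrix.mulVec_mulVec, Matrix.zero_mulVec]
    exact hker _ (by rw [Matrix.mulVec_mulVec, hσE, Matrix.zero_mulVec])
  rwa [Matrix.mul_sub, Matrix.mul_one, sub_eq_zero, eq_comm] at hPE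

lemma exists_polar (X : Matrix ι ι ℂ) :
    ∃ V, opNorm V ≤ 1 ∧ V * CFC.abs X = X ∧ Vᴴ * X = CFC.abs X := by
  have hH : 0 ≤ Xᴴ * X := star_mul_self_nonneg X
  have habs : CFC.sqrt (Xᴴ * X) = CFC.abs X := rfl
  refine ⟨X * invSqrt (Xᴴ * X), ?_, ?_, ?_⟩
  · rw [← opNorm_conjTranspose, opNorm_le_one_iff]
    simpa [Matrix.mul_assoc, conjTranspose_invSqrt] using invSqrt_mul_self_mul_invSqrt_le_one hH
  · rw [← habs, Matrix.mul_assoc]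
    refine mul_invSqrt_mul_sqrt_of_ker_le hH fun v hv => ?_
    rwa [Matrix.conjTranspose_mul_self_mulVec_eq_zero] at hv
  · rw [Matrix.conjTranspose_mul, conjTranspose_invSqrt, Matrix.mul_assoc, invSqrt_mul_self hH,
      habs]

lemma exists_traceNorm_eq (X : Matrix ι ι ℂ) :
    ∃ U, opNorm U ≤ 1 ∧ traceNorm X = (U * X).trace.re := by
  obtain ⟨V, hV, -, hVX⟩ := exists_polar X
  exact ⟨Vᴴ, by rwa [opNorm_conjTranspose], by rw [hVX, traceNorm_eq_re_trace_abs]⟩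

end SquareRoots

section FirstCauchySchwarz

variable {ι : Type*} [Fintype ι]

lemma re_trace_mul_mul_mul_sq_le {α β : Matrix ι ι ℂ} (hα : 0 ≤ α) (hβ : 0 ≤ β)
    (W Y : Matrix ι ι ℂ) :
    (W * α * Y * β).trace.re ^ 2 ≤
      (β * (W * α * Wᴴ)).trace.re * (α * Y * β * Yᴴ).trace.re := by
  classical
  set a := CFC.sqrt α
  set b := CFC.sqrt β
  have ha : a * a = α := CFC.sqrt_mul_sqrt_self α hα
  have hb : b * b = β := CFC.sqrt_mul_sqrt_self β hβ
  have haH : aᴴ = a := conjTranspose_sqrt α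
  have hbH : bᴴ = b := conjTranspose_sqrt β
  have hsplit : (W * α * Y * β).trace = (b * W * a * (a * Y * b)).trace := by
    rw [← ha, ← hb, ← mul_assoc _ b b, Matrix.trace_mul_comm]
    simp only [mul_assoc]
  have hleft : (b * W * a * (b * W * a)ᴴ).trace = (β * (W * α * Wᴴ)).trace := by
    rw [Matrix.conjTranspose_mul, Matrix.conjTranspose_mul, haH, hbH, ← ha, ← hb,
      mul_assoc b b, Matrix.trace_mul_comm b]
    simp only [mul_assoc]
  have hright : (a * Y * b * (a * Y * b)ᴴ).trace = (α * Y * β * Yᴴ).trace := by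
    rw [Matrix.conjTranspose_mul, Matrix.conjTranspose_mul, haH, hbH, ← ha, ← hb,
      ← mul_assoc _ _ a, ← mul_assoc _ _ a, Matrix.trace_mul_comm _ a]
    simp only [mul_assoc]
  rw [hsplit, ← hleft, ← hright]
  exact re_trace_mul_sq_le _ _

variable [DecidableEq ι]

lemma hsNorm_abs (A : Matrix ι ι ℂ) : hsNorm (CFC.abs A) = hsNorm A := by
  rw [hsNorm, hsNorm, conjTranspose_abs, CFC.abs_mul_abs, Matrix.star_eq_conjTranspose]

lemma traceNorm_mul_mul_sq_le (A Y B : Matrix ι ι ℂ) :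
    traceNorm (A * Y * B) ^ 2 ≤
      hsNorm A * hsNorm B * (CFC.abs A * Y * CFC.abs Bᴴ * Yᴴ).trace.re := by
  obtain ⟨U, hU, hUtr⟩ := exists_traceNorm_eq (A * Y * B)
  obtain ⟨V, hV, hVA, -⟩ := exists_polar A
  obtain ⟨V', hV', hVB, -⟩ := exists_polar Bᴴ
  set α := CFC.abs A
  set β := CFC.abs Bᴴ with hβ
  set W := V'ᴴ * U * V with hW_def
  have hα0 : 0 ≤ α := CFC.abs_nonneg A
  have hβ0 : 0 ≤ β := CFC.abs_nonneg Bᴴ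
  have hW : opNorm W ≤ 1 :=
    opNorm_mul_le_one (opNorm_mul_le_one (by rwa [opNorm_conjTranspose]) hU) hV
  have htr : traceNorm (A * Y * B) = (W * α * Y * β).trace.re := by
    have hB : β * V'ᴴ = B := by
      simpa [conjTranspose_abs, hβ] using congr_arg Matrix.conjTranspose hVB
    rw [hUtr, ← hVA, ← hB, hW_def, ← mul_assoc _ β, ← mul_assoc, Matrix.trace_mul_comm]
    simp only [mul_assoc]
  have hweight : (β * (W * α * Wᴴ)).trace.re ≤ hsNorm A * hsNorm B := by
    calc (β * (W * α * Wᴴ)).trace.re ≤ hsNorm β * hsNorm (W * α * Wᴴ) :=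
          re_trace_mul_le_hsNorm_mul_hsNorm _ _
      _ ≤ hsNorm β * hsNorm α := mul_le_mul_of_nonneg_left (hsNorm_conj_le hW α) (hsNorm_nonneg β)
      _ = hsNorm A * hsNorm B := by
        rw [hsNorm_abs, hsNorm_abs, hsNorm_conjTranspose, mul_comm]
  rw [htr]
  refine (re_trace_mul_mul_mul_sq_le hα0 hβ0 W Y).trans (mul_le_mul_of_nonneg_right hweight ?_)
  simpa [mul_assoc] using re_trace_mul_nonneg hα0 (conj_nonneg hβ0 Y)

end FirstCauchySchwarz

section VectorNorms

variable {𝕜 N : Type*} [RCLike 𝕜] [Fintype N]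

lemma l1Norm_nonneg (P : N → 𝕜) : 0 ≤ l1Norm P := Finset.sum_nonneg fun _ _ => norm_nonneg _

lemma l1Norm_smul (t : 𝕜) (P : N → 𝕜) : l1Norm (t • P) = ‖t‖ * l1Norm P := by
  simp only [l1Norm, Pi.smul_apply, norm_smul, Finset.mul_sum]

lemma l1Norm_sub_le (P R : N → 𝕜) : l1Norm (P - R) ≤ l1Norm P + l1Norm R := by
  rw [l1Norm, l1Norm, l1Norm, ← Finset.sum_add_distrib]
  exact Finset.sum_le_sum fun x _ => norm_sub_le _ _

lemma l1Norm_mulVec_le {I : Type*} [Fintype I] {δ : Matrix I N 𝕜} {C : ℝ}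
    (hδ : ∀ x, ∑ i, ‖δ i x‖ ≤ C) (q : N → 𝕜) : l1Norm (δ *ᵥ q) ≤ C * l1Norm q :=
  calc l1Norm (δ *ᵥ q) ≤ ∑ i, ∑ x, ‖δ i x‖ * ‖q x‖ :=
        Finset.sum_le_sum fun i _ => norm_sum_le_of_le _ fun x _ => norm_mul_le _ _
    _ = ∑ x, (∑ i, ‖δ i x‖) * ‖q x‖ := by
        rw [Finset.sum_comm]
        simp only [Finset.sum_mul]
    _ ≤ C * l1Norm q := by
        rw [l1Norm, Finset.mul_sum]
        exact Finset.sum_le_sum fun x _ => mul_le_mul_of_nonneg_right (hδ x) (norm_nonneg _)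

lemma capNorm_nonneg (K : ℝ) (P : N → 𝕜) : 0 ≤ capNorm K P :=
  (l1Norm_nonneg P).trans (le_max_right _ _)

lemma capNorm_smul (K : ℝ) (t : 𝕜) (P : N → 𝕜) : capNorm K (t • P) = ‖t‖ * capNorm K P := by
  rw [capNorm, capNorm, mul_max_of_nonneg _ _ (norm_nonneg t), l1Norm_smul, linftyNorm, linftyNorm,
    norm_smul, mul_left_comm]

lemma capNorm_le_iff {K r : ℝ} (hK : 0 < K) {P : N → 𝕜} :
    capNorm K P ≤ r ↔ (∀ x, K * ‖P x‖ ≤ r) ∧ ∑ x, ‖P x‖ ≤ r := by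
  rw [capNorm, max_le_iff, linftyNorm, l1Norm, and_congr_left_iff]
  intro hsum
  have hr : 0 ≤ r := (l1Norm_nonneg P).trans hsum
  simp only [← le_div_iff₀' hK, pi_norm_le_iff_of_nonneg (div_nonneg hr hK.le)]

lemma capNorm_mono {K : ℝ} (hK : 0 < K) {P R : N → 𝕜} (h : ∀ x, ‖P x‖ ≤ ‖R x‖) :
    capNorm K P ≤ capNorm K R := by
  obtain ⟨hmax, hsum⟩ := (capNorm_le_iff hK (P := R)).1 le_rfl
  exact (capNorm_le_iff hK).2 ⟨fun x => (mul_le_mul_of_nonneg_left (h x) hK.le).trans (hmax x),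
    (Finset.sum_le_sum fun x _ => h x).trans hsum⟩

lemma eq_zero_of_capNorm_eq_zero {K : ℝ} {P : N → 𝕜} (h : capNorm K P = 0) : P = 0 := by
  have hl1 : l1Norm P ≤ 0 := h ▸ le_max_right _ _
  ext x
  rw [Pi.zero_apply, ← norm_le_zero_iff]
  exact (Finset.single_le_sum (fun y _ => norm_nonneg (P y)) (Finset.mem_univ x)).trans hl1

lemma l1Norm_apply_le_of_boundedNorm_le {I : Type*} [Fintype I] {u : (N → 𝕜) →ₗ[𝕜] (I → 𝕜)}
    {K ε : ℝ} (hε : 0 ≤ ε)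
    (hu : boundedNorm (fun P => ENNReal.ofReal (capNorm K P))
      (fun R => ENNReal.ofReal (l1Norm R)) u ≤ ENNReal.ofReal ε) (P : N → 𝕜) :
    l1Norm (u P) ≤ ε * capNorm K P := by
  rcases (capNorm_nonneg K P).eq_or_lt with hP | hP
  · simp [eq_zero_of_capNorm_eq_zero hP.symm, l1Norm, capNorm, linftyNorm]
  have hnorm : ‖((capNorm K P)⁻¹ : 𝕜)‖ = (capNorm K P)⁻¹ := by
    rw [norm_inv, RCLike.norm_ofReal, abs_of_pos hP]
  have hunit : capNorm K (((capNorm K P)⁻¹ : 𝕜) • P) ≤ 1 := by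
    rw [capNorm_smul, hnorm, inv_mul_cancel₀ hP.ne']
  have hle : l1Norm (u (((capNorm K P)⁻¹ : 𝕜) • P)) ≤ ε :=
    (ENNReal.ofReal_le_ofReal_iff hε).1 <|
      (le_iSup₂_of_le (f := fun R (_ : ENNReal.ofReal (capNorm K R) ≤ 1) =>
        ENNReal.ofReal (l1Norm (u R))) _ (ENNReal.ofReal_le_one.2 hunit) le_rfl).trans hu
  rwa [map_smul, l1Norm_smul, hnorm, inv_mul_le_iff₀ hP, mul_comm] at hle

lemma l1Norm_algebraMap_comp (q : N → ℝ) : l1Norm (algebraMap ℝ 𝕜 ∘ q) = l1Norm q := by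
  simp only [l1Norm, Function.comp_apply, norm_algebraMap']

lemma capNorm_algebraMap_comp (K : ℝ) (q : N → ℝ) :
    capNorm K (algebraMap ℝ 𝕜 ∘ q) = capNorm K q := by
  simp only [capNorm, l1Norm_algebraMap_comp, linftyNorm, Pi.norm_def, Function.comp_apply,
    nnnorm_algebraMap']

lemma l1Norm_mulVec_le_of_boundedNorm_le {I : Type*} [Fintype I] {δ : Matrix I N ℝ} {K ε : ℝ}
    (hε : 0 ≤ ε)
    (hδ : boundedNorm (fun P => ENNReal.ofReal (capNorm K P)) (fun R => ENNReal.ofReal (l1Norm R))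
      (δ.map (algebraMap ℝ 𝕜)).mulVecLin ≤ ENNReal.ofReal ε) (q : N → ℝ) :
    l1Norm (δ *ᵥ q) ≤ ε * capNorm K q := by
  have hcomp : δ.map (algebraMap ℝ 𝕜) *ᵥ (algebraMap ℝ 𝕜 ∘ q) = algebraMap ℝ 𝕜 ∘ (δ *ᵥ q) :=
    funext fun i => (RingHom.map_mulVec (algebraMap ℝ 𝕜) δ q i).symm
  simpa only [Matrix.mulVecLin_apply, hcomp, l1Norm_algebraMap_comp, capNorm_algebraMap_comp]
    using l1Norm_apply_le_of_boundedNorm_le hε hδ (algebraMap ℝ 𝕜 ∘ q)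

lemma capNorm_le_sqrt_mul_sqrt {K r s : ℝ} (hK : 0 < K) {P R : N → ℝ} (hP : ∀ x, 0 ≤ P x)
    (hR : ∀ x, 0 ≤ R x) (hPr : capNorm K P ≤ r) (hRs : capNorm K R ≤ s) {q : N → 𝕜}
    (hq : ∀ x, ‖q x‖ ≤ √(P x) * √(R x)) : capNorm K q ≤ √r * √s := by
  rw [capNorm_le_iff hK] at hPr hRs ⊢
  simp only [Real.norm_eq_abs, abs_of_nonneg (hP _), abs_of_nonneg (hR _)] at hPr hRs
  constructor
  · intro x
    calc K * ‖q x‖ ≤ K * (√(P x) * √(R x)) := by gcongr; exact hq x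
      _ = √(K * P x) * √(K * R x) := by
        rw [Real.sqrt_mul hK.le, Real.sqrt_mul hK.le, mul_mul_mul_comm, Real.mul_self_sqrt hK.le]
      _ ≤ √r * √s := by gcongr; exacts [hPr.1 x, hRs.1 x]
  · calc ∑ x, ‖q x‖ ≤ ∑ x, √(P x) * √(R x) := Finset.sum_le_sum fun x _ => hq x
      _ ≤ √(∑ x, P x) * √(∑ x, R x) := Real.sum_sqrt_mul_sqrt_le _ hP hR
      _ ≤ √r * √s := by gcongr; exacts [hPr.2, hRs.2]

end VectorNorms

section OperatorValuedWeights

variable {N ι κ : Type*} [Fintype N] [Fintype ι] [Fintype κ]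

lemma norm_re_trace_factor_le {α β : Matrix ι ι ℂ} (hα : 0 ≤ α) (hβ : 0 ≤ β)
    (a b a' b' : Matrix ι κ ℂ) :
    ‖(α * (a * bᴴ) * β * (a' * b'ᴴ)ᴴ).trace.re‖ ≤
      √(a * aᴴ * (α * (a' * a'ᴴ) * α)).trace.re * √(b * bᴴ * (β * (b' * b'ᴴ) * β)).trace.re := by
  have hαH : αᴴ = α := (IsSelfAdjoint.of_nonneg hα).star_eq
  have hβH : βᴴ = β := (IsSelfAdjoint.of_nonneg hβ).star_eq
  have hsplit : (α * (a * bᴴ) * β * (a' * b'ᴴ)ᴴ).trace = (a'ᴴ * α * a * (bᴴ * β * b')).trace := by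
    rw [Matrix.conjTranspose_mul, Matrix.conjTranspose_conjTranspose, ← Matrix.mul_assoc _ b',
      Matrix.trace_mul_comm _ a'ᴴ]
    simp only [Matrix.mul_assoc]
  have ha : (a'ᴴ * α * a * (a'ᴴ * α * a)ᴴ).trace = (a * aᴴ * (α * (a' * a'ᴴ) * α)).trace := by
    rw [Matrix.mul_assoc _ α, Matrix.mul_assoc, Matrix.trace_mul_comm]
    simp only [Matrix.conjTranspose_mul, Matrix.conjTranspose_conjTranspose, hαH, Matrix.mul_assoc]
    rw [Matrix.trace_mul_comm]
    simp only [Matrix.mul_assoc]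
  have hb : (bᴴ * β * b' * (bᴴ * β * b')ᴴ).trace = (b * bᴴ * (β * (b' * b'ᴴ) * β)).trace := by
    simp only [Matrix.conjTranspose_mul, Matrix.conjTranspose_conjTranspose, hβH]
    rw [← Matrix.mul_assoc _ _ b, ← Matrix.mul_assoc _ _ b, Matrix.trace_mul_comm _ b]
    simp only [Matrix.mul_assoc]
  rw [hsplit, ← ha, ← hb, Real.norm_eq_abs, ← Real.sqrt_mul]
  · exact Real.abs_le_sqrt (re_trace_mul_sq_le _ _)
  · exact re_trace_nonneg (mul_conjTranspose_nonneg _)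

lemma re_trace_sum_smul (α β : Matrix ι ι ℂ) (z : N → Matrix ι ι ℂ) (δ : N → ℝ) :
    (α * (∑ x, δ x • z x) * β * (∑ x, δ x • z x)ᴴ).trace.re =
      ∑ x', δ x' * ∑ x, δ x * (α * z x * β * (z x')ᴴ).trace.re := by
  simp only [Matrix.conjTranspose_sum, Matrix.conjTranspose_smul, Matrix.mul_sum, Matrix.sum_mul,
    Matrix.mul_smul, Matrix.smul_mul, Matrix.trace_sum, Matrix.trace_smul, Complex.re_sum,
    Complex.smul_re, star_trivial, smul_eq_mul]

lemma sum_mul_mulVec_le {I : Type*} [Fintype I] {δ : Matrix I N ℝ} {c : ℝ}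
    (hc : ∀ i x, |δ i x| ≤ c) (q : N → N → ℝ) :
    ∑ i, ∑ x', δ i x' * (δ *ᵥ q x') i ≤ c * ∑ x', l1Norm (δ *ᵥ q x') := by
  rw [Finset.sum_comm]
  simp only [l1Norm, Finset.mul_sum]
  refine Finset.sum_le_sum fun x' _ => Finset.sum_le_sum fun i _ => ?_
  calc δ i x' * (δ *ᵥ q x') i ≤ |δ i x'| * |(δ *ᵥ q x') i| := by
        rw [← abs_mul]
        exact le_abs_self _
    _ ≤ c * ‖(δ *ᵥ q x') i‖ := mul_le_mul_of_nonneg_right (hc i x') (abs_nonneg _)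

variable [DecidableEq ι]

/-- The operator analogue of `capNorm K P ≤ r` for a nonnegative vector `P`: a family of positive
semidefinite matrices with every `K P x` and the sum `∑ x, P x` bounded by `r` in the Loewner
order. -/
def IsCapBounded (K r : ℝ) (P : N → Matrix ι ι ℂ) : Prop :=
  (∀ x, 0 ≤ P x) ∧ (∀ x, K • P x ≤ r • 1) ∧ ∑ x, P x ≤ r • 1

lemma IsCapBounded.capNorm_re_trace_mul_le {K r : ℝ} (hK : 0 < K) {P : N → Matrix ι ι ℂ}
    (hP : IsCapBounded K r P) {R : Matrix ι ι ℂ} (hR : 0 ≤ R) :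
    capNorm K (fun x => (P x * R).trace.re) ≤ r * R.trace.re := by
  have hr : ((r • 1 : Matrix ι ι ℂ) * R).trace.re = r * R.trace.re := by simp
  simp only [capNorm_le_iff hK, Real.norm_eq_abs, abs_of_nonneg (re_trace_mul_nonneg (hP.1 _) hR)]
  rw [← hr]
  constructor
  · intro x
    simpa using re_trace_mul_le_mul_right (hP.2.1 x) hR
  · simpa [Finset.sum_mul] using re_trace_mul_le_mul_right hP.2.2 hR

lemma IsCapBounded.sum_re_trace_conj_le {K r : ℝ} {P : N → Matrix ι ι ℂ}
    (hP : IsCapBounded K r P) {α : Matrix ι ι ℂ} (hα : 0 ≤ α) :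
    ∑ x, (α * P x * α).trace.re ≤ r * hsNorm α ^ 2 := by
  have hαH : αᴴ = α := (IsSelfAdjoint.of_nonneg hα).star_eq
  have h := re_trace_mono (conj_le_conj hP.2.2 α)
  simp only [hαH, Matrix.mul_sum, Matrix.sum_mul, Matrix.trace_sum, Complex.re_sum] at h
  simpa [hsNorm_sq, hαH] using h

lemma IsCapBounded.sum_capNorm_re_trace_le {K r s : ℝ} (hK : 0 < K) (hr : 0 ≤ r) (hs : 0 ≤ s)
    {a b : N → Matrix ι κ ℂ} (ha : IsCapBounded K r fun x => a x * (a x)ᴴ)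
    (hb : IsCapBounded K s fun x => b x * (b x)ᴴ) {α β : Matrix ι ι ℂ} (hα : 0 ≤ α) (hβ : 0 ≤ β) :
    ∑ x', capNorm K (fun x => (α * (a x * (b x)ᴴ) * β * (a x' * (b x')ᴴ)ᴴ).trace.re) ≤
      r * s * (hsNorm α * hsNorm β) := by
  have conj_self_nonneg {γ P : Matrix ι ι ℂ} (hγ : 0 ≤ γ) (hP : 0 ≤ P) : 0 ≤ γ * P * γ := by
    simpa [← Matrix.star_eq_conjTranspose, (IsSelfAdjoint.of_nonneg hγ).star_eq] using
      conj_nonneg hP γ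
  set u : N → ℝ := fun x' => (α * (a x' * (a x')ᴴ) * α).trace.re
  set v : N → ℝ := fun x' => (β * (b x' * (b x')ᴴ) * β).trace.re
  have hu (x') : 0 ≤ α * (a x' * (a x')ᴴ) * α := conj_self_nonneg hα (ha.1 x')
  have hv (x') : 0 ≤ β * (b x' * (b x')ᴴ) * β := conj_self_nonneg hβ (hb.1 x')
  calc _ ≤ ∑ x', √(r * u x') * √(s * v x') := by
        refine Finset.sum_le_sum fun x' _ => capNorm_le_sqrt_mul_sqrt hK
          (fun x => re_trace_mul_nonneg (ha.1 x) (hu x'))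
          (fun x => re_trace_mul_nonneg (hb.1 x) (hv x'))
          (ha.capNorm_re_trace_mul_le hK (hu x')) (hb.capNorm_re_trace_mul_le hK (hv x'))
          fun x => norm_re_trace_factor_le hα hβ _ _ _ _
    _ ≤ √(∑ x', r * u x') * √(∑ x', s * v x') :=
        Real.sum_sqrt_mul_sqrt_le _ (fun x' => mul_nonneg hr (re_trace_nonneg (hu x')))
          fun x' => mul_nonneg hs (re_trace_nonneg (hv x'))
    _ ≤ √((r * hsNorm α) ^ 2) * √((s * hsNorm β) ^ 2) := by
        simp only [← Finset.mul_sum, mul_pow, sq r, sq s, mul_assoc]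
        gcongr
        exacts [ha.sum_re_trace_conj_le hα, hb.sum_re_trace_conj_le hβ]
    _ = r * s * (hsNorm α * hsNorm β) := by
        rw [Real.sqrt_sq (mul_nonneg hr (hsNorm_nonneg α)),
          Real.sqrt_sq (mul_nonneg hs (hsNorm_nonneg β)), mul_mul_mul_comm]

section RealMatrix

variable {I : Type*} [Fintype I] {δ : Matrix I N ℝ} {c ε K r s : ℝ}

lemma IsCapBounded.sum_re_trace_le (hc : ∀ i x, |δ i x| ≤ c) (hc₀ : 0 ≤ c) (hε : 0 ≤ ε)
    (hK : 0 < K) (hδ : ∀ q, l1Norm (δ *ᵥ q) ≤ ε * capNorm K q) (hr : 0 ≤ r) (hs : 0 ≤ s)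
    {a b : N → Matrix ι κ ℂ} (ha : IsCapBounded K r fun x => a x * (a x)ᴴ)
    (hb : IsCapBounded K s fun x => b x * (b x)ᴴ) {α β : Matrix ι ι ℂ} (hα : 0 ≤ α) (hβ : 0 ≤ β) :
    ∑ i, (α * (∑ x, δ i x • (a x * (b x)ᴴ)) * β * (∑ x, δ i x • (a x * (b x)ᴴ))ᴴ).trace.re ≤
      c * ε * (r * s) * (hsNorm α * hsNorm β) := by
  set q : N → N → ℝ := fun x' x => (α * (a x * (b x)ᴴ) * β * (a x' * (b x')ᴴ)ᴴ).trace.re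
  calc _ = ∑ i, ∑ x', δ i x' * (δ *ᵥ q x') i :=
        Finset.sum_congr rfl fun i _ => re_trace_sum_smul α β _ _
    _ ≤ c * ∑ x', l1Norm (δ *ᵥ q x') := sum_mul_mulVec_le hc q
    _ ≤ c * ∑ x', ε * capNorm K (q x') := by gcongr; exact hδ _
    _ ≤ c * (ε * (r * s * (hsNorm α * hsNorm β))) := by
        rw [← Finset.mul_sum]
        gcongr
        exact ha.sum_capNorm_re_trace_le hK hr hs hb hα hβ
    _ = c * ε * (r * s) * (hsNorm α * hsNorm β) := by ring

lemma IsCapBounded.sum_traceNorm_le (hc : ∀ i x, |δ i x| ≤ c) (hc₀ : 0 ≤ c) (hε : 0 ≤ ε)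
    (hK : 0 < K) (hδ : ∀ q, l1Norm (δ *ᵥ q) ≤ ε * capNorm K q) (hr : 0 ≤ r) (hs : 0 ≤ s)
    {a b : N → Matrix ι κ ℂ} (ha : IsCapBounded K r fun x => a x * (a x)ᴴ)
    (hb : IsCapBounded K s fun x => b x * (b x)ᴴ) (A B : Matrix ι ι ℂ) :
    ∑ i, traceNorm (A * (∑ x, δ i x • (a x * (b x)ᴴ)) * B) ≤
      hsNorm A * hsNorm B * √(Fintype.card I * (c * ε * (r * s))) := by
  have hAB : 0 ≤ hsNorm A * hsNorm B := mul_nonneg (hsNorm_nonneg A) (hsNorm_nonneg B)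
  refine (abs_le_of_sq_le_sq' ?_ (mul_nonneg hAB (Real.sqrt_nonneg _))).2
  set Y : I → Matrix ι ι ℂ := fun i => ∑ x, δ i x • (a x * (b x)ᴴ)
  calc (∑ i, traceNorm (A * Y i * B)) ^ 2
      ≤ Fintype.card I * ∑ i, traceNorm (A * Y i * B) ^ 2 := sq_sum_le_card_mul_sum_sq
    _ ≤ Fintype.card I * ∑ i, hsNorm A * hsNorm B *
          (CFC.abs A * Y i * CFC.abs Bᴴ * (Y i)ᴴ).trace.re := by
        gcongr
        exact traceNorm_mul_mul_sq_le A _ B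
    _ ≤ Fintype.card I * (hsNorm A * hsNorm B *
          (c * ε * (r * s) * (hsNorm (CFC.abs A) * hsNorm (CFC.abs Bᴴ)))) := by
        rw [← Finset.mul_sum]
        gcongr
        exact ha.sum_re_trace_le hc hc₀ hε hK hδ hr hs hb (CFC.abs_nonneg A) (CFC.abs_nonneg Bᴴ)
    _ = (hsNorm A * hsNorm B * √(Fintype.card I * (c * ε * (r * s)))) ^ 2 := by
        rw [hsNorm_abs, hsNorm_abs, hsNorm_conjTranspose, mul_pow, Real.sq_sqrt (by positivity)]
        ring

end RealMatrix

end OperatorValuedWeights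

section Blocks

lemma blockDiag_mono {ι N : Type*} {U V : Matrix (ι × N) (ι × N) ℂ}
    (h : U ≤ V) (x : N) : Matrix.blockDiag U x ≤ Matrix.blockDiag V x := by
  rw [Matrix.le_iff] at h ⊢
  exact h.submatrix fun i => (i, x)

variable {ι N : Type*} [DecidableEq N]

lemma blockDiagonal_nonneg [Finite ι] [Finite N] {X : N → Matrix ι ι ℂ}
    (hX : ∀ x, 0 ≤ X x) : 0 ≤ Matrix.blockDiagonal X := by
  classical
  cases nonempty_fintype ι
  cases nonempty_fintype N
  choose B hB using fun x => CStarAlgebra.nonneg_iff_eq_star_mul_self.1 (hX x)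
  simp only [funext hB, Matrix.star_eq_conjTranspose, Matrix.blockDiagonal_mul,
    ← Matrix.blockDiagonal_conjTranspose]
  exact star_mul_self_nonneg _

variable [Fintype ι] [Fintype N]

lemma kronecker_one_conj_blockDiagonal (A B : Matrix ι ι ℂ) (X : N → Matrix ι ι ℂ) :
    (A ⊗ₖ (1 : Matrix N N ℂ)) * Matrix.blockDiagonal X * (B ⊗ₖ (1 : Matrix N N ℂ)) =
      Matrix.blockDiagonal fun x => A * X x * B := by
  simp only [Matrix.kronecker_one, ← Matrix.blockDiagonal_mul]

variable [DecidableEq ι]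

lemma abs_blockDiagonal (X : N → Matrix ι ι ℂ) :
    CFC.abs (Matrix.blockDiagonal X) = Matrix.blockDiagonal fun x => CFC.abs (X x) := by
  refine CFC.sqrt_unique ?_ (blockDiagonal_nonneg fun x => CFC.abs_nonneg _)
  simp only [← Matrix.blockDiagonal_mul, CFC.abs_mul_abs, Matrix.star_eq_conjTranspose,
    Matrix.blockDiagonal_conjTranspose]

lemma traceNorm_blockDiagonal (X : N → Matrix ι ι ℂ) :
    traceNorm (Matrix.blockDiagonal X) = ∑ x, traceNorm (X x) := by
  simp only [traceNorm_eq_re_trace_abs, abs_blockDiagonal, Matrix.trace_blockDiagonal,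
    Complex.re_sum]

lemma blockDiagonal_le_opNorm {X : N → Matrix ι ι ℂ} (hX : ∀ x, (X x).IsHermitian) (x : N) :
    X x ≤ opNorm (Matrix.blockDiagonal X) • 1 := by
  have hsa : IsSelfAdjoint (Matrix.blockDiagonal X) := by
    rw [isSelfAdjoint_iff, Matrix.star_eq_conjTranspose, Matrix.blockDiagonal_conjTranspose]
    simp only [(hX _).eq]
  have h := blockDiag_mono hsa.le_algebraMap_norm_self x
  rw [Matrix.blockDiag_blockDiagonal, Algebra.algebraMap_eq_smul_one, Matrix.blockDiag_smul,
    Pi.smul_apply, Matrix.blockDiag_one] at h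
  exact h

end Blocks

section OperatorSpaces

variable {N : Type*} {Q : ℕ}

/-- The `x`-th diagonal block `ρ(x)` of an element `∑ x, ρ(x) ⊗ |x⟩⟨x|` of `Mat_Q(N)`. -/
def block (z : Matrix (Fin Q) (Fin Q) (N → ℂ)) (x : N) : Matrix (Fin Q) (Fin Q) ℂ :=
  z.map fun v => v x

lemma blockEmbed_eq_blockDiagonal [DecidableEq N] (z : Matrix (Fin Q) (Fin Q) (N → ℂ)) :
    blockEmbed z = Matrix.blockDiagonal (block z) := rfl

/-- The rows of `a` that lie in the block `x`. -/
def rowBlock (a : Matrix (Fin Q × N) (Fin Q × N) ℂ) (x : N) : Matrix (Fin Q) (Fin Q × N) ℂ :=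
  a.submatrix (·, x) id

variable [Fintype N]

lemma rowBlock_mul_conjTranspose (a b : Matrix (Fin Q × N) (Fin Q × N) ℂ) (x : N) :
    rowBlock a x * (rowBlock b x)ᴴ = Matrix.blockDiag (a * bᴴ) x := rfl

lemma Gam_mul_conjTranspose (a : Matrix (Fin Q × N) (Fin Q × N) ℂ) :
    Gam a * (Gam a)ᴴ = ∑ x, rowBlock a x * (rowBlock a x)ᴴ := by
  ext i j
  simp only [Gam, rowBlock, Matrix.mul_apply, Matrix.sum_apply, Matrix.conjTranspose_apply,
    Matrix.submatrix_apply, Matrix.of_apply, Fintype.sum_prod_type, id]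
  rw [Finset.sum_comm]

lemma block_map_mulVecLin {I : Type*} (δ : Matrix I N ℝ) (z : Matrix (Fin Q) (Fin Q) (N → ℂ))
    (i : I) :
    block (z.map (δ.map (algebraMap ℝ ℂ)).mulVecLin) i = ∑ x, δ i x • block z x := by
  ext j k
  simp [block, Matrix.mulVec, dotProduct, Matrix.sum_apply]

variable [DecidableEq N]

lemma factorNorm_nonneg (K : ℝ) (a : Matrix (Fin Q × N) (Fin Q × N) ℂ) : 0 ≤ factorNorm K a :=
  (norm_nonneg (Gam a)).trans (le_max_right _ _)

lemma isCapBounded_rowBlock {K : ℝ} (hK : 0 < K) (a : Matrix (Fin Q × N) (Fin Q × N) ℂ) :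
    IsCapBounded K (factorNorm K a ^ 2) fun x => rowBlock a x * (rowBlock a x)ᴴ := by
  refine ⟨fun x => mul_conjTranspose_nonneg _, fun x => ?_, ?_⟩
  · have hop : opNorm a ^ 2 ≤ K⁻¹ * factorNorm K a ^ 2 := by
      rw [le_inv_mul_iff₀ hK]
      nth_rw 1 [← Real.sq_sqrt hK.le]
      rw [← mul_pow]
      exact pow_le_pow_left₀ (mul_nonneg (Real.sqrt_nonneg K) (norm_nonneg a)) (le_max_left _ _) 2
    have h := blockDiag_mono ((opNorm_sq_le_iff (by positivity)).1 hop) x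
    rw [← rowBlock_mul_conjTranspose, Matrix.blockDiag_smul, Pi.smul_apply,
      Matrix.blockDiag_one, Pi.one_apply, mul_smul, le_inv_smul_iff_of_pos hK] at h
    exact h
  · rw [← Gam_mul_conjTranspose, ← opNorm_sq_le_iff (sq_nonneg _)]
    exact pow_le_pow_left₀ (norm_nonneg (Gam a)) (le_max_right _ _) 2

variable {I : Type*} [Fintype I] [DecidableEq I]

lemma l1OpNorm_map_le {δ : Matrix I N ℝ} {c ε K : ℝ} (hc : ∀ i x, |δ i x| ≤ c) (hc₀ : 0 ≤ c)
    (hε : 0 ≤ ε) (hK : 0 < K) (hδ : ∀ q, l1Norm (δ *ᵥ q) ≤ ε * capNorm K q)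
    {z : Matrix (Fin Q) (Fin Q) (N → ℂ)} {a b : Matrix (Fin Q × N) (Fin Q × N) ℂ}
    (hz : blockEmbed z = a * bᴴ) :
    l1OpNorm Q (z.map (δ.map (algebraMap ℝ ℂ)).mulVecLin) ≤
      ENNReal.ofReal (factorNorm K a * factorNorm K b) *
        ENNReal.ofReal √(Fintype.card I * (c * ε)) := by
  have hblock (x : N) : block z x = rowBlock a x * (rowBlock b x)ᴴ := by
    rw [rowBlock_mul_conjTranspose, ← hz, blockEmbed_eq_blockDiagonal,
      Matrix.blockDiag_blockDiagonal]
  have hF : 0 ≤ factorNorm K a * factorNorm K b :=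
    mul_nonneg (factorNorm_nonneg K a) (factorNorm_nonneg K b)
  rw [← ENNReal.ofReal_mul hF]
  refine iSup₂_le fun A B => iSup₂_le fun hA hB => ENNReal.ofReal_le_ofReal ?_
  rw [blockEmbed_eq_blockDiagonal, kronecker_one_conj_blockDiagonal, traceNorm_blockDiagonal]
  simp only [block_map_mulVecLin, hblock]
  calc _ ≤ hsNorm A * hsNorm B *
        √(Fintype.card I * (c * ε * (factorNorm K a ^ 2 * factorNorm K b ^ 2))) :=
      (isCapBounded_rowBlock hK a).sum_traceNorm_le hc hc₀ hε hK hδ (sq_nonneg _) (sq_nonneg _)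
        (isCapBounded_rowBlock hK b) A B
    _ ≤ 1 * √(Fintype.card I * (c * ε * (factorNorm K a ^ 2 * factorNorm K b ^ 2))) := by
      gcongr
      exact mul_le_one₀ hA (hsNorm_nonneg B) hB
    _ = factorNorm K a * factorNorm K b * √(Fintype.card I * (c * ε)) := by
      rw [one_mul, ← mul_assoc (Fintype.card I : ℝ), Real.sqrt_mul (by positivity), ← mul_pow,
        Real.sqrt_sq hF, mul_comm]

theorem cbNorm_mulVecLin_le {δ : Matrix I N ℝ} {c ε K : ℝ} (hc : ∀ i x, |δ i x| ≤ c)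
    (hc₀ : 0 ≤ c) (hε : 0 ≤ ε) (hK : 0 < K) (hδ : ∀ q, l1Norm (δ *ᵥ q) ≤ ε * capNorm K q) :
    cbNorm (capcapNorm K) l1OpNorm (δ.map (algebraMap ℝ ℂ)).mulVecLin ≤
      ENNReal.ofReal √(Fintype.card I * (c * ε)) := by
  refine iSup₂_le fun Q z => iSup_le fun hz => ?_
  have hdiv : l1OpNorm Q (z.map (δ.map (algebraMap ℝ ℂ)).mulVecLin) /
      ENNReal.ofReal √(Fintype.card I * (c * ε)) ≤ capcapNorm K Q z :=
    le_iInf₂ fun a b => le_iInf fun hab =>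
      ENNReal.div_le_of_le_mul (l1OpNorm_map_le hc hc₀ hε hK hδ hab)
  calc l1OpNorm Q (z.map (δ.map (algebraMap ℝ ℂ)).mulVecLin)
      ≤ capcapNorm K Q z * ENNReal.ofReal √(Fintype.card I * (c * ε)) :=
        (ENNReal.div_le_iff_le_mul (.inr (ne_top_of_le_ne_top ENNReal.one_ne_top hz))
          (.inl ENNReal.ofReal_ne_top)).1 hdiv
    _ ≤ ENNReal.ofReal √(Fintype.card I * (c * ε)) := mul_le_of_le_one_left' hz

end OperatorSpaces
section Conjugation

variable {ι : Type*} [Fintype ι]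

lemma mulVec_eq_zero_of_le {P R : Matrix ι ι ℂ} (hP : 0 ≤ P) (h : P ≤ R) {v : ι → ℂ}
    (hv : R *ᵥ v = 0) : P *ᵥ v = 0 := by
  rw [Matrix.nonneg_iff_posSemidef] at hP
  have hR := (Matrix.le_iff.1 h).dotProduct_mulVec_nonneg v
  rw [Matrix.sub_mulVec, dotProduct_sub, hv, dotProduct_zero, zero_sub, neg_nonneg] at hR
  exact (hP.dotProduct_mulVec_zero_iff v).1 (hR.antisymm (hP.dotProduct_mulVec_nonneg v))

variable [DecidableEq ι]

lemma invSqrt_conj_le {P τ : Matrix ι ι ℂ} {r : ℝ} (hτ : 0 ≤ τ) (hr : 0 ≤ r) (h : P ≤ r • τ) :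
    invSqrt τ * P * invSqrt τ ≤ r • 1 :=
  calc invSqrt τ * P * invSqrt τ ≤ invSqrt τ * (r • τ) * invSqrt τ := by
        simpa only [conjTranspose_invSqrt] using conj_le_conj h (invSqrt τ)
    _ = r • (invSqrt τ * τ * invSqrt τ) := by rw [Matrix.mul_smul, Matrix.smul_mul]
    _ ≤ r • 1 := smul_le_smul_of_nonneg_left (invSqrt_mul_self_mul_invSqrt_le_one hτ) hr

lemma sqrt_mul_invSqrt_conj_mul_sqrt {P τ : Matrix ι ι ℂ} (hτ : 0 ≤ τ) (hP : P.IsHermitian)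
    (hker : ∀ v, τ *ᵥ v = 0 → P *ᵥ v = 0) :
    CFC.sqrt τ * (invSqrt τ * P * invSqrt τ) * CFC.sqrt τ = P := by
  have hright : P * (invSqrt τ * CFC.sqrt τ) = P := mul_invSqrt_mul_sqrt_of_ker_le hτ hker
  have hleft : CFC.sqrt τ * invSqrt τ * P = P := by
    simpa [conjTranspose_sqrt, conjTranspose_invSqrt, hP.eq] using
      congr_arg Matrix.conjTranspose hright
  calc _ = CFC.sqrt τ * invSqrt τ * P * (invSqrt τ * CFC.sqrt τ) := by simp only [mul_assoc]
    _ = P := by rw [hleft, hright]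

lemma le_smul_of_invSqrt_conj_le {P σ : Matrix ι ι ℂ} {t : ℝ} (hσ : 0 ≤ σ) (hP : P.IsHermitian)
    (hker : ∀ v, σ *ᵥ v = 0 → P *ᵥ v = 0) (h : invSqrt σ * P * invSqrt σ ≤ t • 1) :
    P ≤ t • σ := by
  have hconj := conj_le_conj h (CFC.sqrt σ)
  rwa [conjTranspose_sqrt, sqrt_mul_invSqrt_conj_mul_sqrt hσ hP hker, Matrix.mul_smul,
    Matrix.smul_mul, Matrix.mul_one, CFC.sqrt_mul_sqrt_self σ hσ] at hconj

variable {N : Type*} [Fintype N]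

lemma isCapBounded_invSqrt_conj {ρ : N → Matrix ι ι ℂ} {τ : Matrix ι ι ℂ} {K r : ℝ} (hτ : 0 ≤ τ)
    (hr : 0 ≤ r) (hρ : ∀ x, 0 ≤ ρ x) (hKρ : ∀ x, K • ρ x ≤ r • τ) (hsum : ∑ x, ρ x ≤ r • τ) :
    IsCapBounded K r fun x => invSqrt τ * ρ x * invSqrt τ := by
  refine ⟨fun x => ?_, fun x => ?_, ?_⟩
  · simpa only [conjTranspose_invSqrt] using conj_nonneg (hρ x) (invSqrt τ)
  · simpa only [Matrix.mul_smul, Matrix.smul_mul] using invSqrt_conj_le hτ hr (hKρ x)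
  · simpa only [Matrix.mul_sum, Matrix.sum_mul] using invSqrt_conj_le hτ hr hsum

lemma sum_traceNorm_sum_smul_le {I : Type*} [Fintype I] {δ : Matrix I N ℝ} {c ε K r : ℝ}
    (hc : ∀ i x, |δ i x| ≤ c) (hc₀ : 0 ≤ c) (hε : 0 ≤ ε) (hK : 0 < K)
    (hδ : ∀ q, l1Norm (δ *ᵥ q) ≤ ε * capNorm K q) {ρ : N → Matrix ι ι ℂ} {τ : Matrix ι ι ℂ}
    (hτ : 0 ≤ τ) (hr : 0 ≤ r) (hρ : ∀ x, 0 ≤ ρ x) (hKρ : ∀ x, K • ρ x ≤ r • τ)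
    (hsum : ∑ x, ρ x ≤ r • τ) :
    ∑ i, traceNorm (∑ x, δ i x • ρ x) ≤ τ.trace.re * √(Fintype.card I * (c * ε * (r * r))) := by
  set S := CFC.sqrt τ
  set P : N → Matrix ι ι ℂ := fun x => invSqrt τ * ρ x * invSqrt τ
  have hP : IsCapBounded K r P := isCapBounded_invSqrt_conj hτ hr hρ hKρ hsum
  have hfactor (x : N) : CFC.sqrt (P x) * (CFC.sqrt (P x))ᴴ = P x := by
    rw [conjTranspose_sqrt, CFC.sqrt_mul_sqrt_self _ (hP.1 x)]
  have hker (x : N) (v : ι → ℂ) (hv : τ *ᵥ v = 0) : ρ x *ᵥ v = 0 :=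
    mulVec_eq_zero_of_le (hρ x)
      ((Finset.single_le_sum (fun y _ => hρ y) (Finset.mem_univ x)).trans hsum)
      (by rw [Matrix.smul_mulVec, hv, smul_zero])
  have hPρ (x : N) : S * P x * S = ρ x :=
    sqrt_mul_invSqrt_conj_mul_sqrt hτ (IsSelfAdjoint.of_nonneg (hρ x)) (hker x)
  have htr : hsNorm S * hsNorm S = τ.trace.re := by
    rw [← sq, hsNorm_sq, conjTranspose_sqrt, CFC.sqrt_mul_sqrt_self τ hτ]
  have hmain := IsCapBounded.sum_traceNorm_le hc hc₀ hε hK hδ hr hr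
    (a := fun x => CFC.sqrt (P x)) (b := fun x => CFC.sqrt (P x))
    (by simpa only [hfactor] using hP) (by simpa only [hfactor] using hP) S S
  simpa only [hfactor, Matrix.mul_sum, Matrix.sum_mul, Matrix.mul_smul, Matrix.smul_mul, hPρ, htr]
    using hmain

end Conjugation

section States

variable {N : Type*} [Fintype N] {Q : ℕ}

lemma marginal_eq_sum_block (ρ : Matrix (Fin Q) (Fin Q) (N → ℂ)) :
    marginal ρ = ∑ x, block ρ x := by
  ext i j
  rw [Matrix.sum_apply]
  rfl

variable [DecidableEq N] {ρ : Matrix (Fin Q) (Fin Q) (N → ℂ)}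

lemma IsCQState.block_nonneg (h : IsCQState ρ) (x : N) : 0 ≤ block ρ x := by
  have hx := blockDiag_mono h.1.nonneg x
  rwa [blockEmbed_eq_blockDiagonal, Matrix.blockDiag_blockDiagonal] at hx

lemma IsCQState.marginal_nonneg (h : IsCQState ρ) : 0 ≤ marginal ρ := by
  rw [marginal_eq_sum_block]
  exact Finset.sum_nonneg fun x _ => h.block_nonneg x

lemma IsCQState.trace_marginal (h : IsCQState ρ) : (marginal ρ).trace = 1 := by
  rw [← h.2, blockEmbed_eq_blockDiagonal, Matrix.trace_blockDiagonal, marginal_eq_sum_block,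
    Matrix.trace_sum]

lemma IsCQState.block_le_marginal (h : IsCQState ρ) (x : N) : block ρ x ≤ marginal ρ := by
  rw [marginal_eq_sum_block]
  exact Finset.single_le_sum (fun y _ => h.block_nonneg y) (Finset.mem_univ x)

lemma IsCQState.block_le_opNorm_smul (h : IsCQState ρ) {σ : Matrix (Fin Q) (Fin Q) ℂ}
    (hσ : 0 ≤ σ) (hker : ∀ v, σ *ᵥ v = 0 → marginal ρ *ᵥ v = 0) (x : N) :
    block ρ x ≤ opNorm ((invSqrt σ ⊗ₖ (1 : Matrix N N ℂ)) * blockEmbed ρ *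
      (invSqrt σ ⊗ₖ (1 : Matrix N N ℂ))) • σ := by
  have hherm (y : N) : (block ρ y).IsHermitian := IsSelfAdjoint.of_nonneg (h.block_nonneg y)
  have hconj (y : N) : (invSqrt σ * block ρ y * invSqrt σ).IsHermitian := by
    simpa only [conjTranspose_invSqrt] using
      Matrix.isHermitian_mul_mul_conjTranspose (invSqrt σ) (hherm y)
  rw [blockEmbed_eq_blockDiagonal, kronecker_one_conj_blockDiagonal]
  exact le_smul_of_invSqrt_conj_le hσ (hherm x)
    (fun v hv => mulVec_eq_zero_of_le (h.block_nonneg x) (h.block_le_marginal x) (hker v hv))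
    (blockDiagonal_le_opNorm hconj x)

lemma IsCQState.exists_block_le_smul (h : IsCQState ρ) {k t : ℝ} (hk : k ≤ condMinEntropy ρ)
    (ht : (2 : ℝ) ^ (-k) < t) :
    ∃ σ : Matrix (Fin Q) (Fin Q) ℂ, 0 ≤ σ ∧ σ.trace = 1 ∧ ∀ x, block ρ x ≤ t • σ := by
  rw [condMinEntropy, le_neg] at hk
  set T : Set ℝ := {r : ℝ | ∃ σ : Matrix (Fin Q) (Fin Q) ℂ, σ.PosSemidef ∧ σ.trace = 1 ∧
    (∀ v, σ *ᵥ v = 0 → marginal ρ *ᵥ v = 0) ∧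
    r = opNorm ((invSqrt σ ⊗ₖ (1 : Matrix N N ℂ)) * blockEmbed ρ *
      (invSqrt σ ⊗ₖ (1 : Matrix N N ℂ)))}
  have hne : T.Nonempty := ⟨_, marginal ρ, Matrix.nonneg_iff_posSemidef.1 h.marginal_nonneg,
    h.trace_marginal, fun _ hv => hv, rfl⟩
  have hT₀ : 0 ≤ sInf T := Real.sInf_nonneg <| by
    rintro _ ⟨σ, -, -, -, rfl⟩
    exact norm_nonneg _
  have hlt : sInf T < t := by
    rcases hT₀.eq_or_lt with h0 | h0
    · rw [← h0]
      exact (Real.rpow_pos_of_pos two_pos _).trans ht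
    · exact ((Real.logb_le_iff_le_rpow one_lt_two h0).1 hk).trans_lt ht
  obtain ⟨_, ⟨σ, hσ, htr, hker, rfl⟩, hop⟩ := exists_lt_of_csInf_lt hne hlt
  exact ⟨σ, hσ.nonneg, htr, fun x => (h.block_le_opNorm_smul hσ.nonneg hker x).trans
    (smul_le_smul_of_nonneg_right hop.le hσ.nonneg)⟩

end States

section Extractors

lemma card_mul_inv_card_mul_le (M D : Type*) [Fintype M] [Fintype D] {e : ℝ}
    (he : 0 ≤ e) : Fintype.card (M × D) * ((Fintype.card D : ℝ)⁻¹ * e) ≤ Fintype.card M * e := by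
  rw [Fintype.card_prod, Nat.cast_mul, mul_assoc, ← mul_assoc (Fintype.card D : ℝ)]
  gcongr
  exact mul_le_of_le_one_left he mul_inv_le_one

variable {N D M : Type*} [Fintype D] [Fintype M] [DecidableEq M]

/-- The real matrix of the linear map `deltaS`. -/
noncomputable def deltaMatrix (f : D → N → M) : Matrix (M × D) N ℝ :=
  Matrix.of fun p x => (Fintype.card D : ℝ)⁻¹ *
    ((if f p.2 x = p.1 then 1 else 0) - (Fintype.card M : ℝ)⁻¹)

lemma abs_deltaMatrix_le (f : D → N → M) (p : M × D) (x : N) :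
    |deltaMatrix f p x| ≤ (Fintype.card D : ℝ)⁻¹ := by
  have hM₀ : (0 : ℝ) ≤ (Fintype.card M : ℝ)⁻¹ := by positivity
  have hM₁ : (Fintype.card M : ℝ)⁻¹ ≤ 1 := Nat.cast_inv_le_one _
  rw [deltaMatrix, Matrix.of_apply, abs_mul, abs_of_nonneg (by positivity)]
  refine mul_le_of_le_one_right (by positivity) ?_
  split_ifs <;> rw [abs_le] <;> constructor <;> linarith

lemma sum_abs_deltaMatrix_le (f : D → N → M) (x : N) : ∑ p, |deltaMatrix f p x| ≤ 2 := by
  have hM₀ : (0 : ℝ) ≤ (Fintype.card M : ℝ)⁻¹ := by positivity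
  calc ∑ p, |deltaMatrix f p x|
      ≤ ∑ p : M × D, (Fintype.card D : ℝ)⁻¹ *
          ((if f p.2 x = p.1 then 1 else 0) + (Fintype.card M : ℝ)⁻¹) := by
        refine Finset.sum_le_sum fun p _ => ?_
        rw [deltaMatrix, Matrix.of_apply, abs_mul, abs_of_nonneg (by positivity)]
        refine mul_le_mul_of_nonneg_left ((abs_sub _ _).trans_eq ?_) (by positivity)
        rw [abs_of_nonneg hM₀, abs_of_nonneg (by positivity)]
    _ = (Fintype.card D : ℝ)⁻¹ * (Fintype.card D *
          (1 + Fintype.card M * (Fintype.card M : ℝ)⁻¹)) := by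
        rw [← Finset.mul_sum, Fintype.sum_prod_type_right]
        simp only [Finset.sum_add_distrib, Finset.sum_ite_eq, Finset.mem_univ, if_true,
          Finset.sum_const, Finset.card_univ, nsmul_eq_mul, ← mul_add]
    _ ≤ 1 * (1 + 1) := by
        rw [← mul_assoc]
        gcongr
        exacts [inv_mul_le_one, mul_inv_le_one]
    _ = 2 := by norm_num

variable [Fintype N]

lemma deltaS_eq_mulVecLin (𝕜 : Type*) [RCLike 𝕜] (f : D → N → M) :
    deltaS 𝕜 f = ((deltaMatrix f).map (algebraMap ℝ 𝕜)).mulVecLin := by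
  ext1 P
  funext p
  change (Fintype.card D : 𝕜)⁻¹ * ∑ x, (if f p.2 x = p.1 then 1 else 0) * P x -
    (∑ x, P x) * ((Fintype.card M : 𝕜)⁻¹ * (Fintype.card D : 𝕜)⁻¹) =
      ∑ x, algebraMap ℝ 𝕜 (deltaMatrix f p x) * P x
  rw [Finset.mul_sum, Finset.sum_mul, ← Finset.sum_sub_distrib]
  refine Finset.sum_congr rfl fun x _ => ?_
  simp only [deltaMatrix, Matrix.of_apply, map_mul, map_sub, map_inv₀, map_natCast,
    apply_ite (algebraMap ℝ 𝕜), map_one, map_zero]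
  ring

lemma deltaS_real_apply (f : D → N → M) (q : N → ℝ) : deltaS ℝ f q = deltaMatrix f *ᵥ q := by
  rw [deltaS_eq_mulVecLin, Matrix.mulVecLin_apply, Algebra.algebraMap_self, RingHom.coe_id,
    Matrix.map_id]

lemma l1Norm_deltaS_le_two_mul (f : D → N → M) (q : N → ℝ) :
    l1Norm (deltaS ℝ f q) ≤ 2 * l1Norm q := by
  rw [deltaS_real_apply]
  exact l1Norm_mulVec_le (sum_abs_deltaMatrix_le f) q

lemma l1Norm_deltaS_le_of_boundedNorm_le {𝕜 : Type*} [RCLike 𝕜] {f : D → N → M} {K ε : ℝ}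
    (hK : 0 < K) (hε : 0 < ε)
    (hf : boundedNorm (fun P => ENNReal.ofReal (capNorm K P)) (fun R => ENNReal.ofReal (l1Norm R))
      (deltaS 𝕜 f) ≤ ENNReal.ofReal ε) (q : N → ℝ) :
    l1Norm (deltaS ℝ f q) ≤ 2 * ε * capNorm (K / ε) q := by
  rcases le_total ε 1 with hε₁ | hε₁
  · rw [deltaS_eq_mulVecLin] at hf
    rw [deltaS_real_apply]
    have hmono : capNorm K q ≤ capNorm (K / ε) q :=
      max_le_max_right _ (mul_le_mul_of_nonneg_right (le_div_self hK.le hε hε₁) (norm_nonneg q))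
    calc l1Norm (deltaMatrix f *ᵥ q) ≤ ε * capNorm K q :=
          l1Norm_mulVec_le_of_boundedNorm_le hε.le hf q
      _ ≤ 2 * ε * capNorm (K / ε) q :=
        mul_le_mul (by linarith) hmono (capNorm_nonneg K q) (by positivity)
  · calc l1Norm (deltaS ℝ f q) ≤ 2 * l1Norm q := l1Norm_deltaS_le_two_mul f q
      _ ≤ 2 * ε * capNorm (K / ε) q :=
        mul_le_mul (by linarith) (le_max_right _ _) (l1Norm_nonneg q) (by positivity)

theorem cbNorm_deltaS_le [DecidableEq D] [DecidableEq N] {𝕜 : Type*} [RCLike 𝕜] {f : D → N → M}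
    {K ε : ℝ} (hK : 0 < K) (hε : 0 < ε)
    (hf : boundedNorm (fun P => ENNReal.ofReal (capNorm K P)) (fun R => ENNReal.ofReal (l1Norm R))
      (deltaS 𝕜 f) ≤ ENNReal.ofReal ε) :
    cbNorm (capcapNorm (K / ε)) l1OpNorm (deltaS ℂ f) ≤
      ENNReal.ofReal √(Fintype.card M * (2 * ε)) := by
  rw [deltaS_eq_mulVecLin]
  refine (cbNorm_mulVecLin_le (abs_deltaMatrix_le f) (by positivity)
    (by positivity : 0 ≤ 2 * ε) (div_pos hK hε) fun q => ?_).trans ?_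
  · rw [← deltaS_real_apply]
    exact l1Norm_deltaS_le_of_boundedNorm_le hK hε hf q
  · exact ENNReal.ofReal_le_ofReal
      (Real.sqrt_le_sqrt (card_mul_inv_card_mul_le M D (by positivity)))

end Extractors

section QuantumProof

variable {N D M : Type*} [Fintype N] [Fintype D] [Fintype M] [DecidableEq M]

lemma le_minEntropy {P : N → ℝ} (hP : P ≠ 0) {k : ℝ} (hk : ∀ x, (2 : ℝ) ^ k * ‖P x‖ ≤ 1) :
    k ≤ minEntropy P := by
  have hpow : (0 : ℝ) < 2 ^ k := Real.rpow_pos_of_pos two_pos k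
  rw [minEntropy, le_neg, linftyNorm, Real.logb_le_iff_le_rpow one_lt_two (norm_pos_iff.2 hP),
    Real.rpow_neg two_pos.le, pi_norm_le_iff_of_nonneg (inv_nonneg.2 hpow.le)]
  exact fun x => (le_inv_mul_iff₀ hpow).2 (hk x) |>.trans_eq (mul_one _)

lemma l1Norm_deltaS_of_sum_eq_one (f : D → N → M) {P : N → ℝ} (hP : ∑ x, P x = 1) :
    l1Norm (deltaS ℝ f P) = (Fintype.card D : ℝ)⁻¹ *
      ∑ s, l1Norm (push ℝ (f s) P - fun _ => (Fintype.card M : ℝ)⁻¹) := by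
  have hD : (0 : ℝ) ≤ (Fintype.card D : ℝ)⁻¹ := by positivity
  have happly (y : M) (s : D) : deltaS ℝ f P (y, s) = (Fintype.card D : ℝ)⁻¹ *
      (push ℝ (f s) P - fun _ => (Fintype.card M : ℝ)⁻¹ : M → ℝ) y := by
    change _ * _ - (∑ x, P x) * _ = _ * (_ - _)
    rw [hP]
    ring
  simp only [l1Norm, Fintype.sum_prod_type_right, happly, norm_mul, Real.norm_of_nonneg hD,
    Finset.mul_sum]

namespace IsStrongExtractor

variable {f : D → N → M} {k ε : ℝ}

lemma l1Norm_deltaS_le_of_nonneg (h : IsStrongExtractor f k ε) (hε : 0 < ε) {q : N → ℝ}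
    (hq : ∀ x, 0 ≤ q x) : l1Norm (deltaS ℝ f q) ≤ 2 * ε * capNorm (2 ^ k / ε) q := by
  have hpow : (0 : ℝ) < 2 ^ k := Real.rpow_pos_of_pos two_pos k
  set t := capNorm (2 ^ k / ε) q
  have ht : 0 ≤ t := capNorm_nonneg _ _
  obtain ⟨hmax, hsum⟩ := (capNorm_le_iff (div_pos hpow hε)).1 (le_refl t)
  simp only [Real.norm_of_nonneg (hq _)] at hmax hsum
  have hl1 : l1Norm q = ∑ x, q x := by simp only [l1Norm, Real.norm_of_nonneg (hq _)]
  set S := ∑ x, q x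
  rcases le_or_gt S (ε * t) with hS | hS
  · calc l1Norm (deltaS ℝ f q) ≤ 2 * S := hl1 ▸ l1Norm_deltaS_le_two_mul f q
      _ ≤ 2 * ε * t := by linarith
  have hS₀ : 0 < S := (by positivity : 0 ≤ ε * t).trans_lt hS
  have hnorm : ∑ x, (S⁻¹ • q) x = 1 := by
    simp only [Pi.smul_apply, smul_eq_mul, ← Finset.mul_sum]
    exact inv_mul_cancel₀ hS₀.ne'
  have hnonneg (x : N) : 0 ≤ (S⁻¹ • q) x := mul_nonneg (inv_nonneg.2 hS₀.le) (hq x)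
  have hent : k ≤ minEntropy (S⁻¹ • q) := by
    have hne : S⁻¹ • q ≠ 0 := fun h0 => by
      simp only [h0, Pi.zero_apply, Finset.sum_const_zero, zero_ne_one] at hnorm
    refine le_minEntropy hne fun x => ?_
    have hx : 2 ^ k * q x ≤ ε * t := by
      simpa only [div_mul_eq_mul_div, div_le_iff₀' hε] using hmax x
    rw [Real.norm_of_nonneg (hnonneg x), Pi.smul_apply, smul_eq_mul, mul_left_comm,
      inv_mul_le_iff₀ hS₀, mul_one]
    exact hx.trans hS.le
  have hext := h _ hnonneg hnorm hent
  rw [← l1Norm_deltaS_of_sum_eq_one f hnorm, map_smul, l1Norm_smul,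
    Real.norm_of_nonneg (inv_nonneg.2 hS₀.le), inv_mul_le_iff₀ hS₀] at hext
  calc l1Norm (deltaS ℝ f q) ≤ S * ε := hext
    _ ≤ t * ε := by gcongr
    _ ≤ 2 * ε * t := by nlinarith

lemma l1Norm_deltaS_le (h : IsStrongExtractor f k ε) (hε : 0 < ε) (q : N → ℝ) :
    l1Norm (deltaS ℝ f q) ≤ 4 * ε * capNorm (2 ^ k / ε) q := by
  have hK : (0 : ℝ) < 2 ^ k / ε := div_pos (Real.rpow_pos_of_pos two_pos k) hε
  have hpos : capNorm (2 ^ k / ε) q⁺ ≤ capNorm (2 ^ k / ε) q := capNorm_mono hK fun x => by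
    rw [Pi.posPart_apply, Real.norm_of_nonneg (posPart_nonneg _)]
    exact sup_le (le_abs_self _) (abs_nonneg _)
  have hneg : capNorm (2 ^ k / ε) q⁻ ≤ capNorm (2 ^ k / ε) q := capNorm_mono hK fun x => by
    rw [Pi.negPart_apply, Real.norm_of_nonneg (negPart_nonneg _)]
    exact sup_le (neg_le_abs _) (abs_nonneg _)
  calc l1Norm (deltaS ℝ f q) = l1Norm (deltaS ℝ f q⁺ - deltaS ℝ f q⁻) := by
        rw [← map_sub, posPart_sub_negPart]
    _ ≤ l1Norm (deltaS ℝ f q⁺) + l1Norm (deltaS ℝ f q⁻) := l1Norm_sub_le _ _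
    _ ≤ 2 * ε * capNorm (2 ^ k / ε) q⁺ + 2 * ε * capNorm (2 ^ k / ε) q⁻ :=
        add_le_add (h.l1Norm_deltaS_le_of_nonneg hε fun x => posPart_nonneg q x)
          (h.l1Norm_deltaS_le_of_nonneg hε fun x => negPart_nonneg q x)
    _ ≤ 2 * ε * capNorm (2 ^ k / ε) q + 2 * ε * capNorm (2 ^ k / ε) q := by gcongr
    _ = 4 * ε * capNorm (2 ^ k / ε) q := by ring

end IsStrongExtractor

lemma sum_traceNorm_push_sub_eq {Q : ℕ} (f : D → N → M) (ρ : Matrix (Fin Q) (Fin Q) (N → ℂ)) :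
    (Fintype.card D : ℝ)⁻¹ *
        ∑ s, traceNorm (blockEmbed (ρ.map (push ℂ (f s)) - tensorUniform M (marginal ρ))) =
      ∑ p, traceNorm (∑ x, deltaMatrix f p x • block ρ x) := by
  have hblock (y : M) (s : D) : ∑ x, deltaMatrix f (y, s) x • block ρ x =
      (Fintype.card D : ℝ)⁻¹ •
        block (ρ.map (push ℂ (f s)) - tensorUniform M (marginal ρ)) y := by
    rw [← block_map_mulVecLin, ← deltaS_eq_mulVecLin]
    ext i j
    simp only [block, marginal, tensorUniform, deltaS, Matrix.map_apply, Matrix.smul_apply,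
      Matrix.sub_apply, Pi.sub_apply, LinearMap.coe_mk, AddHom.coe_mk, Complex.real_smul]
    push_cast
    ring
  have hD : (0 : ℝ) ≤ (Fintype.card D : ℝ)⁻¹ := by positivity
  simp only [Fintype.sum_prod_type_right, hblock, traceNorm_smul hD, blockEmbed_eq_blockDiagonal,
    traceNorm_blockDiagonal, Finset.mul_sum]

theorem IsStrongExtractor.isQuantumProofStrongExtractor [DecidableEq N] {f : D → N → M} {k ε : ℝ}
    (h : IsStrongExtractor f k ε) (hε : 0 < ε) :
    IsQuantumProofStrongExtractor f (k + Real.logb 2 (2 / ε))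
      (4 * √(Fintype.card M * ε)) := by
  intro Q ρ hρ hk
  have hK : (0 : ℝ) < 2 ^ k / ε := div_pos (Real.rpow_pos_of_pos two_pos k) hε
  have hlt : (2 : ℝ) ^ (-(k + Real.logb 2 (2 / ε))) < (2 ^ k / ε)⁻¹ := by
    rw [Real.rpow_neg two_pos.le, Real.rpow_add two_pos,
      Real.rpow_logb two_pos (by norm_num) (by positivity), mul_div_assoc',
      inv_lt_inv₀ (by positivity) hK]
    gcongr
    exact lt_mul_of_one_lt_right (by positivity) one_lt_two
  obtain ⟨σ, hσ, hσtr, hρσ⟩ := hρ.exists_block_le_smul hk hlt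
  have hρτ (x : N) : (2 ^ k / ε) • block ρ x ≤ (1 : ℝ) • (σ + marginal ρ) := by
    rw [one_smul, ← le_inv_smul_iff_of_pos hK]
    exact (hρσ x).trans (smul_le_smul_of_nonneg_left (le_add_of_nonneg_right hρ.marginal_nonneg)
      (inv_nonneg.2 hK.le))
  have hsum : ∑ x, block ρ x ≤ (1 : ℝ) • (σ + marginal ρ) := by
    rw [one_smul, ← marginal_eq_sum_block]
    exact le_add_of_nonneg_left hσ
  rw [sum_traceNorm_push_sub_eq]
  calc _ ≤ (σ + marginal ρ).trace.re *
        √(Fintype.card (M × D) * ((Fintype.card D : ℝ)⁻¹ * (4 * ε) * (1 * 1))) :=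
        sum_traceNorm_sum_smul_le (abs_deltaMatrix_le f) (by positivity) (by positivity) hK
          (fun q => deltaS_real_apply f q ▸ h.l1Norm_deltaS_le hε q)
          (add_nonneg hσ hρ.marginal_nonneg) zero_le_one hρ.block_nonneg hρτ hsum
    _ ≤ 2 * √(2 ^ 2 * (Fintype.card M * ε)) := by
        rw [Matrix.trace_add, hσtr, hρ.trace_marginal, mul_one, mul_one]
        gcongr ?_ * √?_
        · norm_num
        · exact (card_mul_inv_card_mul_le M D (by positivity)).trans_eq (by ring)
    _ = 4 * √(Fintype.card M * ε) := by
        rw [Real.sqrt_mul (by positivity), Real.sqrt_sq two_pos.le]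
        ring

end QuantumProof

end QExt

theorem theorem3_general {𝕜 N D M : Type*} [RCLike 𝕜] [Fintype N] [DecidableEq N] [Fintype D]
    [DecidableEq D] [Fintype M] [DecidableEq M] (f : D → N → M) (k ε : ℝ) (hε : 0 < ε) :
    (QExt.boundedNorm
          (fun P => ENNReal.ofReal (QExt.capNorm ((2 : ℝ) ^ k) P))
          (fun R => ENNReal.ofReal (QExt.l1Norm R))
          (QExt.deltaS 𝕜 f) ≤ ENNReal.ofReal ε →
      QExt.cbNorm
          (QExt.capcapNorm ((2 : ℝ) ^ (k + Real.logb 2 (1 / ε))))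
          QExt.l1OpNorm
          (QExt.deltaS ℂ f)
        ≤ ENNReal.ofReal (4 * √(Fintype.card M) * √(2 * ε))) ∧
    (QExt.IsStrongExtractor f k ε →
      QExt.IsQuantumProofStrongExtractor f (k + Real.logb 2 (2 / ε))
        (12 * √(Fintype.card M) * √(2 * ε))) := by
  have hK : (2 : ℝ) ^ (k + Real.logb 2 (1 / ε)) = 2 ^ k / ε := by
    rw [Real.rpow_add two_pos, Real.rpow_logb two_pos (by norm_num) (by positivity), mul_one_div]
  refine ⟨fun hf => ?_, fun hf Q ρ hρ hk => ?_⟩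
  · rw [hK]
    refine (QExt.cbNorm_deltaS_le (Real.rpow_pos_of_pos two_pos k) hε hf).trans ?_
    rw [Real.sqrt_mul (Nat.cast_nonneg _), mul_assoc]
    exact ENNReal.ofReal_le_ofReal (le_mul_of_one_le_left (by positivity) (by norm_num))
  · refine (hf.isQuantumProofStrongExtractor hε Q ρ hρ hk).trans ?_
    rw [Real.sqrt_mul (Nat.cast_nonneg _), mul_assoc]
    gcongr <;> linarith

theorem theorem3 {𝕜 : Type*} [RCLike 𝕜] {n d m' : ℕ}
    (f : (Fin d → Bool) → (Fin n → Bool) → (Fin m' → Bool)) (k ε : ℝ) (hε : 0 < ε) :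
    (QExt.boundedNorm
          (fun P => ENNReal.ofReal (QExt.capNorm ((2 : ℝ) ^ k) P))
          (fun R => ENNReal.ofReal (QExt.l1Norm R))
          (QExt.deltaS 𝕜 f) ≤ ENNReal.ofReal ε →
      QExt.cbNorm
          (QExt.capcapNorm ((2 : ℝ) ^ (k + Real.logb 2 (1 / ε))))
          QExt.l1OpNorm
          (QExt.deltaS ℂ f)
        ≤ ENNReal.ofReal (4 * Real.sqrt ((2 : ℝ) ^ m') * Real.sqrt (2 * ε))) ∧
    (QExt.IsStrongExtractor f k ε →
      QExt.IsQuantumProofStrongExtractor f (k + Real.logb 2 (2 / ε))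
        (12 * Real.sqrt ((2 : ℝ) ^ m') * Real.sqrt (2 * ε))) := by
  simpa using theorem3_general (𝕜 := 𝕜) f k ε hε
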